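/- **Setting.** Let $T,d,N\ge 1$ be integers, $\mathbb T=\{0,\dots,T\}$, and let $(\Omega,\mathcal F,\mathbb P)$ be a probability space with a filtration $(\mathcal F_t)_{t\in\mathbb T}$ such that $\mathcal F_T=\mathcal F$ and $\mathcal F_0$ is trivial (its events have probability $0$ or $1$). For $x\in\mathbb R^{d+N}$ write $x=(x^F,x^I)\in\mathbb R^d\times\mathbb R^N$, and for $E\subset\mathbb R^{d+N}$ put $\underline E=E\cap(\mathbb R^d\times\{0\})$. $L^0(E;\mathcal G)$ is the set of $\mathcal G$-measurable random variables with values in $E$ a.s. ($\mathcal G=\mathcal F$ if omitted). Relations between random objects are understood $\mathbb P$-a.s. - $\mathcal K$ is the set of processes $K=(K_t)_{t\in\mathbb T}$ of random cones in $\mathbb R^{d+N}$ for which there is a sequence $(X^n)_n$ of adapted $\mathbb R^{d+N}$-valued processes such that for every $t$, a.s., a finite but nonzero number of the $X^n_t$ are nonzero and $K_t=\mathrm{cone}\{X^n_t:n\in\mathbb N\}$, and such that $\mathbb R^{d+N}_+\setminus\{0\}\subset\mathrm{int}(K_t)$ a.s. - $\mathcal R$ is the set of processes $R=(R_t)_{t\in\mathbb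 T}$ of random maps $R_t:\mathbb R^N_+\to\mathbb R^d\times\{0\}$ such that $R_t(x)$ is $\mathcal F_t$-measurable for each $x\in\mathbb R^N_+$. - For a process $\xi$ put $I(\xi)_t=\sum_{s=0}^t\xi^I_s$. For $x\in\mathbb R^d\times\mathbb R^N_+$, $\mathcal A(x;K)$ is the set of adapted $\mathbb R^{d+N}$-valued processes $\xi$ with $\xi_t\in-K_t$ and $I(\xi)_t+x^I\in\mathbb R^N_+$ a.s. for all $t\in\mathbb T$. Let $A_T(x;K,R)$ be the set of random variables $x+\sum_{t=0}^T\xi_t+\sum_{t=0}^{T-1}R_{t+1}(x^I+I(\xi)_t)$ with $\xi\in\mathcal A(x;K)$, and let $A_T^s(x;K,R)=A_T(x;K,R)-L^0(K_T)$. **Assumptions.** $(K,R)\in\mathcal K\times\mathcal R$ satisfies, for each $t\in\mathbb T$: - (R1) a.s., $R_t(0)=0$ and $R_t$ is continuous on $\mathbb R_+^N$. - (R2) For $\lambda\in[0,1]$ and $\alpha,\beta\in L^0(\mathbb R^N_+)$: $\lambda R_t(\alpha)+(1-\lambda)R_t(\beta)-R_t(\lambda\alpha+(1-\lambda)\beta)\in-\underline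 K_t$ a.s. - (R3) There are $a_t\in L^0(\mathbb R^{d+N})$ and $L\in\mathcal R$ such that for all $(\lambda,\alpha)\in L^0(\mathbb R_+\times\mathbb R_+^N)$, a.s., $\lambda L_t(\alpha)=L_t(\lambda\alpha)$ and $R_t(\alpha)+a_t+L_t(\alpha)\in\mathbb R^{d+N}_+$. - $NA^r(K,R)$: there is $(\tilde K,\tilde R)\in\mathcal K\times\mathcal R$, where $\tilde R_t(\alpha)$ is a.s. equal to an $\mathcal F_t$-measurable random variable for every $t\in\mathbb T$ and $\alpha\in L^0(\mathbb R^N_+;\mathcal F_t)$, such that $A_T(0;\tilde K,\tilde R)\cap L^0(\mathbb R^{d+N}_+)=\{0\}$ and, a.s. for each $t\in\mathbb T$, with $\underline K^0_t=\underline K_t\cap(-\underline K_t)$: - (D1) $\underline K_t\setminus\underline K_t^0\subset\mathrm{ri}(\tilde K_t)$ and $K_t\subset\tilde K_t$; - (D2) $\tilde R_t(0)\in\underline K_t$, and $\tilde R_t(y)-R_t(y)\in\mathrm{ri}(\underline K_t)$ for all $y\in\mathbb R_+^N\setminus\{0\}$. **Definition.** For $t\in\mathbb T$ and $\alpha\in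 L^0(\mathbb R_+^N;\mathcal F_t)$ let $\mathcal Y^{t,\alpha}(K)$ be the set of adapted $\mathbb R^{d+N}$-valued processes $\xi$ such that, a.s., $\xi_s=0$ for $s<t$, $\xi_s\in-K_s$ for $t\le s\le T$, and $I(\xi)_s+\alpha\in\mathbb R^N_+$ for $t\le s\le T-1$. Let $Y^t_T(K,R)$ be the set of pairs $(\alpha,g)\in L^0(\mathbb R_+^N;\mathcal F_t)\times L^0(\mathbb R^{d+N};\mathcal F_T)$ for which some $\xi\in\mathcal Y^{t,\alpha}(K)$ satisfies $$\sum_{s=t}^T\xi_s+\sum_{s=t}^{T-1}R_{s+1}(I(\xi)_s+\alpha)=g\quad\text{a.s.}$$ **Lemma.** Under these assumptions, for every $t\in\mathbb T$ the set $Y^t_T(K,R)$ is closed for the convergence in probability: if $(\alpha_n,g_n)\in Y^t_T(K,R)$ for all $n$ and $\alpha_n\to\alpha$, $g_n\to g$ in probability with $\alpha$ $\mathcal F_t$-measurable and $g$ $\mathcal F_T$-measurable, then $(\alpha,g)\in Y^t_T(K,R)$. Consequently, for every $x\in\mathbb R^d\times\mathbb R^N_+$, $A_T^s(x;K,R)$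 is closed in probability. -/

import Mathlib

open MeasureTheory Set Filter Topology

/-- Portfolios `x = (x^F, x^I)` in units of `d` financial and `N` industrial assets. The order is the
componentwise one, so `0 ≤ x` says that all `d + N` components are nonnegative. (The norm of this
space matters only through its topology, which is the Euclidean one.) -/
abbrev Portfolio (d N : ℕ) : Type := (Fin d → ℝ) × (Fin N → ℝ)

/-- The purely financial elements of `E`, that is `E ∩ (ℝ^d × {0})`. -/
def financial {d N : ℕ} (E : Set (Portfolio d N)) : Set (Portfolio d N) := {x | x ∈ E ∧ x.2 = 0}

/-- The linear space `F ∩ (-F)` contained in a cone `F`. -/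
def lineality {d N : ℕ} (F : Set (Portfolio d N)) : Set (Portfolio d N) := {x | x ∈ F ∧ -x ∈ F}

section Model

variable {Ω : Type*} {m : MeasurableSpace Ω} {d N : ℕ}

/-- `K` belongs to the class of solvency cone processes: at each date `t ≤ T`, almost surely, `K_t` is
the polyhedral cone generated by finitely many values of a countable family of adapted processes
(at least one of them nonzero), and its interior contains all nonzero portfolios with nonnegative
components. -/
structure IsSolvencyProcess (μ : Measure Ω) (ℱ : Filtration ℕ m) (T : ℕ)
    (K : ℕ → Ω → Set (Portfolio d N)) : Prop where
  generated : ∃ X : ℕ → ℕ → Ω → Portfolio d N,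
    (∀ n, ∀ t ≤ T, Measurable[ℱ t] (X n t)) ∧
    ∀ t ≤ T, ∀ᵐ ω ∂μ, {n | X n t ω ≠ 0}.Finite ∧ {n | X n t ω ≠ 0}.Nonempty ∧
      K t ω = (PointedCone.hull ℝ (Set.range fun n => X n t ω) : Set (Portfolio d N))
  pos_mem_interior : ∀ t ≤ T, ∀ᵐ ω ∂μ, ∀ x : Portfolio d N, 0 ≤ x → x ≠ 0 → x ∈ interior (K t ω)

/-- `R` belongs to the class of return processes: adapted processes of maps from `ℝ_+^N` to the
financial portfolios `ℝ^d × {0}`. Only the values at nonnegative arguments are used. -/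
structure IsReturnProcess (ℱ : Filtration ℕ m) (T : ℕ)
    (R : ℕ → Ω → (Fin N → ℝ) → Portfolio d N) : Prop where
  adapted : ∀ t ≤ T, ∀ x : Fin N → ℝ, 0 ≤ x → Measurable[ℱ t] (fun ω => R t ω x)
  financial : ∀ t ≤ T, ∀ ω, ∀ x : Fin N → ℝ, 0 ≤ x → (R t ω x).2 = 0

/-- `R_t(α)` is (almost surely equal to) an `ℱ_t`-measurable random variable whenever `α` is an
`ℱ_t`-measurable random variable with values in `ℝ_+^N`. -/
def IsRandomMap (μ : Measure Ω) (ℱ : Filtration ℕ m) (T : ℕ)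
    (R : ℕ → Ω → (Fin N → ℝ) → Portfolio d N) : Prop :=
  ∀ t ≤ T, ∀ α : Ω → Fin N → ℝ, Measurable[ℱ t] α → (∀ᵐ ω ∂μ, 0 ≤ α ω) →
    AEStronglyMeasurable[ℱ t] (fun ω => R t ω (α ω)) μ

/-- No return without investment, and continuity of the return maps on `ℝ_+^N`. -/
def CondR1 (μ : Measure Ω) (T : ℕ) (R : ℕ → Ω → (Fin N → ℝ) → Portfolio d N) : Prop :=
  ∀ t ≤ T, ∀ᵐ ω ∂μ, R t ω 0 = 0 ∧ ContinuousOn (R t ω) {x | 0 ≤ x}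

/-- Concavity up to a transaction in the financial assets. -/
def CondR2 (μ : Measure Ω) (T : ℕ) (K : ℕ → Ω → Set (Portfolio d N))
    (R : ℕ → Ω → (Fin N → ℝ) → Portfolio d N) : Prop :=
  ∀ t ≤ T, ∀ c : ℝ, 0 ≤ c → c ≤ 1 → ∀ α β : Ω → Fin N → ℝ, Measurable α → Measurable β →
    (∀ᵐ ω ∂μ, 0 ≤ α ω) → (∀ᵐ ω ∂μ, 0 ≤ β ω) →
    ∀ᵐ ω ∂μ, -(c • R t ω (α ω) + (1 - c) • R t ω (β ω) - R t ω (c • α ω + (1 - c) • β ω))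
      ∈ financial (K t ω)

/-- Affine lower bound by a return process that is positively homogeneous. -/
def CondR3 (μ : Measure Ω) (ℱ : Filtration ℕ m) (T : ℕ)
    (R : ℕ → Ω → (Fin N → ℝ) → Portfolio d N) : Prop :=
  ∀ t ≤ T, ∃ (a : Ω → Portfolio d N) (L : ℕ → Ω → (Fin N → ℝ) → Portfolio d N),
    Measurable a ∧ IsReturnProcess ℱ T L ∧
    ∀ (c : Ω → ℝ) (α : Ω → Fin N → ℝ), Measurable c → Measurable α →
      (∀ᵐ ω ∂μ, 0 ≤ c ω) → (∀ᵐ ω ∂μ, 0 ≤ α ω) →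
      (∀ᵐ ω ∂μ, c ω • L t ω (α ω) = L t ω (c ω • α ω)) ∧
      (∀ᵐ ω ∂μ, 0 ≤ R t ω (α ω) + a ω + L t ω (α ω))

/-- The cumulated industrial investment `I(ξ)_t = ∑_{s ≤ t} ξ_s^I`. -/
def invested (ξ : ℕ → Ω → Portfolio d N) (t : ℕ) (ω : Ω) : Fin N → ℝ :=
  ∑ s ∈ Finset.range (t + 1), (ξ s ω).2

/-- The strategies with initial holding `x`: adapted processes `ξ` with `ξ_t ∈ -K_t` and
`I(ξ)_t + x^I ∈ ℝ_+^N` almost surely for all `t ≤ T`. -/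
def admissible (μ : Measure Ω) (ℱ : Filtration ℕ m) (T : ℕ) (K : ℕ → Ω → Set (Portfolio d N))
    (x : Portfolio d N) : Set (ℕ → Ω → Portfolio d N) :=
  {ξ | ∀ t ≤ T, Measurable[ℱ t] (ξ t) ∧
    (∀ᵐ ω ∂μ, -ξ t ω ∈ K t ω) ∧ ∀ᵐ ω ∂μ, 0 ≤ invested ξ t ω + x.2}

/-- The set `A_T(x; K, R)` of claims that can be reached from the initial holding `x`. -/
def attainable (μ : Measure Ω) (ℱ : Filtration ℕ m) (T : ℕ) (K : ℕ → Ω → Set (Portfolio d N))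
    (R : ℕ → Ω → (Fin N → ℝ) → Portfolio d N) (x : Portfolio d N) : Set (Ω → Portfolio d N) :=
  {g | Measurable[ℱ T] g ∧ ∃ ξ ∈ admissible μ ℱ T K x, ∀ᵐ ω ∂μ,
    g ω = x + ∑ t ∈ Finset.range (T + 1), ξ t ω
      + ∑ t ∈ Finset.range T, R (t + 1) ω (x.2 + invested ξ t ω)}

/-- The `K_T`-solid envelope `A_T^s(x; K, R) = A_T(x; K, R) - L^0(K_T)`. -/
def solidAttainable (μ : Measure Ω) (ℱ : Filtration ℕ m) (T : ℕ)
    (K : ℕ → Ω → Set (Portfolio d N)) (R : ℕ → Ω → (Fin N → ℝ) → Portfolio d N)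
    (x : Portfolio d N) : Set (Ω → Portfolio d N) :=
  {g | Measurable[ℱ T] g ∧ ∃ f ∈ attainable μ ℱ T K R x, ∃ k : Ω → Portfolio d N,
    Measurable[ℱ T] k ∧ (∀ᵐ ω ∂μ, k ω ∈ K T ω) ∧ ∀ᵐ ω ∂μ, g ω = f ω - k ω}

/-- No arbitrage: `A_T(0; K, R) ∩ L^0(ℝ_+^{d+N}) = {0}`, up to null sets. -/
def NoArbitrage (μ : Measure Ω) (ℱ : Filtration ℕ m) (T : ℕ) (K : ℕ → Ω → Set (Portfolio d N))
    (R : ℕ → Ω → (Fin N → ℝ) → Portfolio d N) : Prop :=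
  ∀ g : Ω → Portfolio d N, Measurable[ℱ T] g →
    ((g ∈ attainable μ ℱ T K R 0 ∧ ∀ᵐ ω ∂μ, 0 ≤ g ω) ↔ ∀ᵐ ω ∂μ, g ω = 0)

/-- `(K', R')` dominates `(K, R)`; the relative interior is `intrinsicInterior`. -/
structure Dominates (μ : Measure Ω) (T : ℕ)
    (K' : ℕ → Ω → Set (Portfolio d N)) (R' : ℕ → Ω → (Fin N → ℝ) → Portfolio d N)
    (K : ℕ → Ω → Set (Portfolio d N)) (R : ℕ → Ω → (Fin N → ℝ) → Portfolio d N) : Prop where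
  cones : ∀ t ≤ T, ∀ᵐ ω ∂μ,
    financial (K t ω) \ lineality (financial (K t ω)) ⊆ intrinsicInterior ℝ (K' t ω) ∧
    K t ω ⊆ K' t ω
  returns : ∀ t ≤ T, ∀ᵐ ω ∂μ, R' t ω 0 ∈ financial (K t ω) ∧
    ∀ x : Fin N → ℝ, 0 ≤ x → x ≠ 0 →
      R' t ω x - R t ω x ∈ intrinsicInterior ℝ (financial (K t ω))

/-- Robust no-arbitrage: no arbitrage for some model that dominates `(K, R)`. -/
def RobustNoArbitrage (μ : Measure Ω) (ℱ : Filtration ℕ m) (T : ℕ)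
    (K : ℕ → Ω → Set (Portfolio d N)) (R : ℕ → Ω → (Fin N → ℝ) → Portfolio d N) : Prop :=
  ∃ (K' : ℕ → Ω → Set (Portfolio d N)) (R' : ℕ → Ω → (Fin N → ℝ) → Portfolio d N),
    IsSolvencyProcess μ ℱ T K' ∧ IsReturnProcess ℱ T R' ∧ IsRandomMap μ ℱ T R' ∧
    Dominates μ T K' R' K R ∧ NoArbitrage μ ℱ T K' R'

/-- The strategies trading from date `t` on, with industrial holding `α` at date `t`: adapted
processes `ξ` with `ξ_s = 0` for `s < t`, `ξ_s ∈ -K_s` for `t ≤ s ≤ T`, and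
`I(ξ)_s + α ∈ ℝ_+^N` for `t ≤ s ≤ T - 1`, almost surely. -/
def strategiesFrom (μ : Measure Ω) (ℱ : Filtration ℕ m) (T : ℕ)
    (K : ℕ → Ω → Set (Portfolio d N)) (t : ℕ) (α : Ω → Fin N → ℝ) :
    Set (ℕ → Ω → Portfolio d N) :=
  {ξ | (∀ s ≤ T, Measurable[ℱ s] (ξ s)) ∧
    (∀ s < t, ∀ᵐ ω ∂μ, ξ s ω = 0) ∧
    (∀ s, t ≤ s → s ≤ T → ∀ᵐ ω ∂μ, -ξ s ω ∈ K s ω) ∧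
    (∀ s, t ≤ s → s < T → ∀ᵐ ω ∂μ, 0 ≤ invested ξ s ω + α ω)}

/-- The set `Y_T^t(K, R)` of pairs `(α, g)` with `α ∈ L^0(ℝ_+^N; ℱ_t)` and `g ∈ L^0(ℝ^{d+N}; ℱ_T)`
the terminal wealth of a strategy trading from date `t` on. -/
def wealthFrom (μ : Measure Ω) (ℱ : Filtration ℕ m) (T : ℕ) (K : ℕ → Ω → Set (Portfolio d N))
    (R : ℕ → Ω → (Fin N → ℝ) → Portfolio d N) (t : ℕ) :
    Set ((Ω → Fin N → ℝ) × (Ω → Portfolio d N)) :=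
  {p | Measurable[ℱ t] p.1 ∧ (∀ᵐ ω ∂μ, 0 ≤ p.1 ω) ∧ Measurable[ℱ T] p.2 ∧
    ∃ ξ ∈ strategiesFrom μ ℱ T K t p.1, ∀ᵐ ω ∂μ,
      ∑ s ∈ Finset.Icc t T, ξ s ω
        + ∑ s ∈ Finset.Ico t T, R (s + 1) ω (invested ξ s ω + p.1 ω) = p.2 ω}

end Model

/-! Reachability is shown to be closed under almost sure convergence by backward induction on `t`
(`ReachableClosed.pred`). Extracting almost surely convergent subsequences then gives closedness in
probability. At date `T` only closedness of the finitely generated cone `K_T` is needed. For the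
induction step, let `ξ n` lead from `α n` to `g n`. Where the norms of the first transfers `ξ n t`
do not tend to infinity, these transfers converge along a random `ℱ t`-measurable subsequence. What
remains is a convergent problem started at `t + 1`, because the return maps are continuous
(`ReachableClosed.exists_limit`).

Where the norms tend to infinity, the strategies are scaled by `1 / max 1 ‖ξ n t‖`. Concavity and
`R_s(0) = 0` put the surplus `R_s(c x) - c R_s(x)` in `K_s`, so the scaled strategies stay feasible
once it is given up (`IsStrategyFor.exists_smul`). The scaled data tend to zero, which yields a
strategy `z` from holding 0 to wealth 0 with `z t ≠ 0` (`ReachableClosed.exists_direction`).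

Robust no-arbitrage forces `z` to consist of reversible financial transfers
(`RobustNoArbitrage.ae_mem_lineality`). Otherwise some position would be interior to a dominating
cone, and a little of the first asset could be withdrawn from it for free. Multiples of `z` can
therefore be subtracted from `ξ n` without changing holdings or wealth. Choosing them as in Gaussian
elimination removes one financial coordinate from all `ξ n t` (`ReachableClosed.exists_reduction`),
and this can happen at most `d` times.

For the solid envelope, `g` lies in `A_T^s(x)` exactly when `(x^I, g - x)` lies in `Y_T^0`, since
the disposal of an element of `K_T` can be merged with the last transfer. -/

/-! ### Finitely generated cones are closed. -/

section FiniteCones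

variable {E : Type*} [AddCommGroup E] [Module ℝ E]

/-- The nonnegative combinations of a finite set of vectors. -/
def combinations (s : Finset E) : Set E :=
  {y | ∃ c : E → ℝ, (∀ v ∈ s, 0 ≤ c v) ∧ ∑ v ∈ s, c v • v = y}

theorem combinations_subset_of_subset {s t : Finset E} (h : s ⊆ t) :
    combinations s ⊆ combinations t := by
  classical
  rintro y ⟨c, hc, rfl⟩
  refine ⟨fun v => if v ∈ s then c v else 0, fun v _ => ?_, ?_⟩
  · dsimp only
    split_ifs with hv
    · exact hc v hv
    · exact le_rfl
  · simp only [ite_smul, zero_smul, ← Finset.sum_filter]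
    congr 1
    ext v
    simpa using fun hv => h hv

/-- The reduction step in Carathéodory's theorem for cones. -/
theorem combinations_eq_biUnion_erase [DecidableEq E] {s : Finset E}
    (hs : ¬ LinearIndependent ℝ ((↑) : s → E)) :
    combinations s = ⋃ v ∈ s, combinations (s.erase v) := by
  apply Subset.antisymm
  · rintro y ⟨c, hc, rfl⟩
    obtain ⟨r, hr, v, hv, hrv⟩ : ∃ r : E → ℝ, ∑ v ∈ s, r v • v = 0 ∧ ∃ v ∈ s, 0 < r v := by
      rw [Fintype.linearIndependent_iff] at hs
      push Not at hs
      obtain ⟨g, hg, ⟨w, hw⟩, hgw⟩ := hs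
      have key : ∑ v ∈ s, (if h : v ∈ s then g ⟨v, h⟩ else 0) • v = 0 := by
        rw [← hg, ← Finset.sum_coe_sort s]
        refine Finset.sum_congr rfl fun i _ => ?_
        simp
      rcases lt_or_gt_of_ne hgw with h | h
      · refine ⟨fun v => -(if h : v ∈ s then g ⟨v, h⟩ else 0), ?_, w, hw, ?_⟩
        · simp only [neg_smul, Finset.sum_neg_distrib, key, neg_zero]
        · simpa [hw] using h
      · exact ⟨_, key, w, hw, by simpa [hw] using h⟩
    -- The minimal ratio is the largest multiple of the relation `r` that can be subtracted from `c`
    -- with all coefficients staying nonnegative; the coefficient of `w` becomes zero.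
    obtain ⟨w, hw, hmin⟩ := (s.filter fun v => 0 < r v).exists_min_image (fun v => c v / r v)
      ⟨v, by simp [hv, hrv]⟩
    simp only [Finset.mem_filter] at hw hmin
    refine mem_biUnion hw.1 ⟨fun v => c v - c w / r w * r v, fun v hv => ?_, ?_⟩
    · have hvs := Finset.mem_of_mem_erase hv
      rw [sub_nonneg]
      have h0 : 0 ≤ c w / r w := div_nonneg (hc w hw.1) hw.2.le
      rcases lt_or_ge 0 (r v) with h | h
      · exact (le_div_iff₀ h).1 (hmin v ⟨hvs, h⟩)
      · exact (mul_nonpos_of_nonneg_of_nonpos h0 h).trans (hc v hvs)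
    · have hz : (c w - c w / r w * r w) • w = 0 := by
        rw [div_mul_cancel₀ _ hw.2.ne', sub_self, zero_smul]
      refine (Finset.sum_erase s (f := fun v => (c v - c w / r w * r v) • v) hz).trans ?_
      simp only [sub_smul, mul_smul, Finset.sum_sub_distrib, ← Finset.smul_sum, hr, smul_zero,
        sub_zero]
  · exact iUnion₂_subset fun v _ => combinations_subset_of_subset (Finset.erase_subset v s)

/-- Linearly independent generators give the image of a closed orthant under a closed embedding.
Otherwise Carathéodory's reduction writes the cone as a finite union of cones with fewer generators.
-/
theorem isClosed_combinations [TopologicalSpace E] [IsTopologicalAddGroup E] [ContinuousSMul ℝ E]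
    [T2Space E] (s : Finset E) : IsClosed (combinations s) := by
  classical
  induction s using Finset.strongInduction with
  | H s ih =>
    by_cases hs : LinearIndependent ℝ ((↑) : s → E)
    · have hinj : Function.Injective (Fintype.linearCombination ℝ ((↑) : s → E)) := by
        rwa [← linearIndependent_iff_injective_fintypeLinearCombination]
      have hemb := LinearMap.isClosedEmbedding_of_injective (LinearMap.ker_eq_bot.2 hinj)
      have himg : combinations s
          = Fintype.linearCombination ℝ ((↑) : s → E) '' {c | 0 ≤ c} := by
        ext y
        constructor
        · rintro ⟨c, hc, rfl⟩
          refine ⟨fun v => c v, fun v => hc v v.2, ?_⟩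
          rw [Fintype.linearCombination_apply]
          exact Finset.sum_coe_sort s fun v => c v • v
        · rintro ⟨c, hc, rfl⟩
          refine ⟨fun v => if h : v ∈ s then c ⟨v, h⟩ else 0, fun v hv => ?_, ?_⟩
          · simpa [hv] using hc ⟨v, hv⟩
          · rw [Fintype.linearCombination_apply, ← Finset.sum_coe_sort s]
            exact Finset.sum_congr rfl fun i _ => by simp
      rw [himg]
      exact hemb.isClosedMap _ isClosed_Ici
    · rw [combinations_eq_biUnion_erase hs]
      exact s.finite_toSet.isClosed_biUnion fun v hv => ih _ (Finset.erase_ssubset hv)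

theorem coe_hull_finset (s : Finset E) :
    (PointedCone.hull ℝ (s : Set E) : Set E) = combinations s := by
  ext y
  rw [SetLike.mem_coe, Submodule.mem_span_finset]
  constructor
  · rintro ⟨f, -, rfl⟩
    exact ⟨fun v => f v, fun v _ => (f v).2, rfl⟩
  · rintro ⟨c, hc, rfl⟩
    classical
    refine ⟨fun v => if h : v ∈ s then ⟨c v, hc v h⟩ else 0, fun v => ?_, ?_⟩
    · simp only [Function.mem_support, ne_eq, dite_eq_right_iff, not_forall, Finset.mem_coe]
      exact fun ⟨h, _⟩ => h
    · refine Finset.sum_congr rfl fun v hv => ?_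
      simp only [hv, dif_pos]
      rfl

theorem isClosed_hull_range [TopologicalSpace E] [IsTopologicalAddGroup E] [ContinuousSMul ℝ E]
    [T2Space E] {X : ℕ → E} (hX : {n | X n ≠ 0}.Finite) :
    IsClosed (PointedCone.hull ℝ (range X) : Set E) := by
  classical
  have h : (range X \ {0}) = ((hX.toFinset.image X : Finset E) : Set E) := by
    ext y
    simp only [Set.mem_sdiff, mem_range, mem_singleton_iff, Finset.coe_image, Finite.coe_toFinset,
      mem_image, mem_ofPred_eq]
    constructor
    · rintro ⟨⟨n, rfl⟩, h⟩
      exact ⟨n, h, rfl⟩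
    · rintro ⟨n, h, rfl⟩
      exact ⟨⟨n, rfl⟩, h⟩
  have h2 : PointedCone.hull ℝ (range X) = PointedCone.hull ℝ (range X \ {0}) :=
    Submodule.span_sdiff_singleton_zero.symm
  rw [h2, h, coe_hull_finset]
  exact isClosed_combinations _

end FiniteCones

/-! ### Deterministic geometry of solvency cones. -/

/-- A closed convex cone of portfolios having all nonzero nonnegative ones in its interior. -/
structure IsSolvencyCone {d N : ℕ} (F : Set (Portfolio d N)) : Prop where
  zero_mem : 0 ∈ F
  add_mem : ∀ {x y}, x ∈ F → y ∈ F → x + y ∈ F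
  smul_mem : ∀ {c : ℝ} {x}, 0 ≤ c → x ∈ F → c • x ∈ F
  isClosed : IsClosed F
  pos_mem_interior : ∀ x : Portfolio d N, 0 ≤ x → x ≠ 0 → x ∈ interior F

/-- One unit of the first financial asset. -/
def unitAsset (d N : ℕ) : Portfolio d N := (fun i => if (i : ℕ) = 0 then 1 else 0, 0)

theorem unitAsset_nonneg (d N : ℕ) : 0 ≤ unitAsset d N :=
  ⟨fun i => by simp only [unitAsset]; split_ifs <;> norm_num, le_rfl⟩

theorem unitAsset_ne_zero {d N : ℕ} (hd : 1 ≤ d) : unitAsset d N ≠ 0 := fun h => by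
  have := congrFun (congrArg Prod.fst h) ⟨0, hd⟩
  simp [unitAsset] at this

namespace IsSolvencyCone

variable {d N : ℕ} {F : Set (Portfolio d N)}

theorem nonneg_mem (h : IsSolvencyCone F) {x : Portfolio d N} (hx : 0 ≤ x) : x ∈ F := by
  by_cases h0 : x = 0
  · exact h0 ▸ h.zero_mem
  · exact interior_subset (h.pos_mem_interior x hx h0)

theorem sum_mem (h : IsSolvencyCone F) {ι : Type*} (s : Finset ι) {f : ι → Portfolio d N}
    (hf : ∀ i ∈ s, f i ∈ F) : ∑ i ∈ s, f i ∈ F :=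
  Finset.sum_induction f (· ∈ F) (fun _ _ => h.add_mem) h.zero_mem hf

theorem add_mem_interior (h : IsSolvencyCone F) {x y : Portfolio d N} (hx : x ∈ interior F)
    (hy : y ∈ F) : x + y ∈ interior F := by
  rw [mem_interior] at hx ⊢
  obtain ⟨U, hU, hUo, hxU⟩ := hx
  refine ⟨(fun z => z - y) ⁻¹' U, fun z hz => ?_, hUo.preimage (by fun_prop), by simpa using hxU⟩
  simpa using h.add_mem (hU hz) hy

theorem smul_lineality (h : IsSolvencyCone F) (c : ℝ) {x : Portfolio d N}
    (hx : x ∈ lineality (financial F)) : c • x ∈ F := by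
  rcases le_total 0 c with hc | hc
  · exact h.smul_mem hc hx.1.1
  · have := h.smul_mem (neg_nonneg.2 hc) hx.2.1
    simpa using this

/-- Reduces interior solvency to countably many conditions, each with a deterministic amount to
withdraw; this amount is the gain of the arbitrage built later. -/
theorem _root_.exists_sub_unitAsset_mem {F : Set (Portfolio d N)} {x : Portfolio d N}
    (hx : x ∈ interior F) : ∃ n : ℕ, x - (1 / ((n : ℝ) + 1)) • unitAsset d N ∈ F := by
  have ht : Tendsto (fun n : ℕ => x - (1 / ((n : ℝ) + 1)) • unitAsset d N) atTop (𝓝 x) := by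
    have := (tendsto_one_div_add_atTop_nhds_zero_nat (𝕜 := ℝ)).smul_const (unitAsset d N)
    simpa using tendsto_const_nhds.sub this
  exact (ht.eventually (mem_interior_iff_mem_nhds.1 hx)).exists

/-- `unitAsset` is interior, so adding its negative makes 0 interior, and a cone that is a
neighbourhood of 0 is everything. -/
theorem eq_univ_of_neg_unitAsset_mem (h : IsSolvencyCone F) (hd : 1 ≤ d)
    (hF : -unitAsset d N ∈ F) : F = univ := by
  have h0 : (0 : Portfolio d N) ∈ interior F := by
    have := h.add_mem_interior
      (h.pos_mem_interior _ (unitAsset_nonneg d N) (unitAsset_ne_zero hd)) hF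
    simpa using this
  refine eq_univ_of_forall fun x => ?_
  have ht : Tendsto (fun n : ℕ => (1 / ((n : ℝ) + 1)) • x) atTop (𝓝 0) := by
    simpa using (tendsto_one_div_add_atTop_nhds_zero_nat (𝕜 := ℝ)).smul_const x
  obtain ⟨n, hn⟩ := (ht.eventually (mem_interior_iff_mem_nhds.1 h0)).exists
  have := h.smul_mem (c := (n : ℝ) + 1) (by positivity) hn
  have h1 : ((n : ℝ) + 1) ≠ 0 := by positivity
  simpa [smul_smul, h1] using this

theorem intrinsicInterior_eq (h : IsSolvencyCone F) (hd : 1 ≤ d) :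
    intrinsicInterior ℝ F = interior F := by
  have hne : (interior F).Nonempty :=
    ⟨_, h.pos_mem_interior _ (unitAsset_nonneg d N) (unitAsset_ne_zero hd)⟩
  have htop : affineSpan ℝ F = ⊤ := affineSpan_eq_top_of_nonempty_interior
    (hne.mono (interior_mono (subset_convexHull ℝ F)))
  refine Subset.antisymm (fun x hx => ?_) interior_subset_intrinsicInterior
  rw [mem_intrinsicInterior] at hx
  obtain ⟨y, hy, rfl⟩ := hx
  have ho : IsOpenMap ((↑) : affineSpan ℝ F → Portfolio d N) := by
    apply IsOpen.isOpenMap_subtype_val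
    rw [htop]
    exact isOpen_univ
  have := ho.image_interior_subset _ (mem_image_of_mem _ hy)
  exact interior_mono (image_preimage_subset _ _) this

/-- A relative interior point of a financial cone can only be reversible if the cone contains a
line through the first asset, so that every portfolio is solvent. -/
theorem mem_intrinsicInterior_financial (h : IsSolvencyCone F) (hd : 1 ≤ d) {x : Portfolio d N}
    (hx : x ∈ intrinsicInterior ℝ (financial F)) (hneg : -x ∈ F) : F = univ := by
  rw [mem_intrinsicInterior] at hx
  obtain ⟨y, hy, rfl⟩ := hx
  have hyF : (y : Portfolio d N) ∈ financial F := by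
    simpa using interior_subset hy
  have hu : unitAsset d N ∈ financial F := ⟨h.nonneg_mem (unitAsset_nonneg d N), rfl⟩
  -- A small step from `y` against `unitAsset` stays in the affine span, hence in the cone by
  -- relative interiority. Adding `-y` then leaves a negative multiple of `unitAsset`.
  have hmem : ∀ n : ℕ, AffineMap.lineMap (y : Portfolio d N)
      ((y : Portfolio d N) + unitAsset d N) (-(1 / ((n : ℝ) + 1))) ∈ affineSpan ℝ (financial F) :=
    fun n => AffineMap.lineMap_mem _ y.2 <| subset_affineSpan ℝ _
      ⟨h.add_mem hyF.1 hu.1, by simp [hyF.2, hu.2]⟩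
  have ht : Tendsto (fun n : ℕ => (⟨_, hmem n⟩ : affineSpan ℝ (financial F))) atTop (𝓝 y) := by
    rw [tendsto_subtype_rng]
    have := (tendsto_one_div_add_atTop_nhds_zero_nat (𝕜 := ℝ)).smul_const (unitAsset d N)
    simpa [AffineMap.lineMap_apply, neg_smul] using this.neg.add_const (y : Portfolio d N)
  obtain ⟨n, hn⟩ := (ht.eventually (mem_interior_iff_mem_nhds.1 hy)).exists
  have hn' : (-(1 / ((n : ℝ) + 1))) • unitAsset d N + (y : Portfolio d N) ∈ F := by
    have := hn.1
    simpa [AffineMap.lineMap_apply] using this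
  have h1 := h.smul_mem (c := (n : ℝ) + 1) (by positivity) (h.add_mem hn' hneg)
  have h2 : ((n : ℝ) + 1) ≠ 0 := by positivity
  refine h.eq_univ_of_neg_unitAsset_mem hd ?_
  simpa [smul_smul, h2] using h1

end IsSolvencyCone

/-! ### Solvency cone processes and measurability of solvency. -/

section Model

variable {Ω : Type*} {m : MeasurableSpace Ω} {μ : Measure Ω} {ℱ : Filtration ℕ m} {T d N : ℕ}
  {K : ℕ → Ω → Set (Portfolio d N)}

theorem IsSolvencyProcess.ae_isSolvencyCone (hK : IsSolvencyProcess μ ℱ T K) :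
    ∀ᵐ ω ∂μ, ∀ t ≤ T, IsSolvencyCone (K t ω) := by
  obtain ⟨X, -, hX⟩ := hK.generated
  rw [ae_all_iff]
  intro t
  by_cases ht : t ≤ T
  · filter_upwards [hX t ht, hK.pos_mem_interior t ht] with ω h1 h2 _
    obtain ⟨hfin, -, heq⟩ := h1
    refine ⟨?_, ?_, ?_, ?_, h2⟩
    · rw [heq]; exact zero_mem (PointedCone.hull ℝ _)
    · rw [heq]; exact fun hx hy => add_mem hx hy
    · rw [heq]
      exact fun hc hx => (PointedCone.hull ℝ _).smul_mem hc hx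
    · rw [heq]; exact isClosed_hull_range hfin
  · exact ae_of_all _ fun ω h => absurd h ht

theorem measurableSet_dist_lt {Ω E : Type*} {_ : MeasurableSpace Ω} [PseudoMetricSpace E]
    [SecondCountableTopology E] [MeasurableSpace E] [OpensMeasurableSpace E] {f g : Ω → E}
    (hf : Measurable f) (hg : Measurable g) {ε : ℝ} :
    MeasurableSet {ω | dist (f ω) (g ω) < ε} :=
  measurableSet_lt (hf.dist hg) measurable_const

/-- The event that an adapted position is solvent is adapted, up to a null set. -/
theorem IsSolvencyProcess.exists_measurableSet_mem (hK : IsSolvencyProcess μ ℱ T K) {t : ℕ}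
    (ht : t ≤ T) {y : Ω → Portfolio d N} (hy : Measurable[ℱ t] y) :
    ∃ A : Set Ω, MeasurableSet[ℱ t] A ∧ ∀ᵐ ω ∂μ, ω ∈ A ↔ y ω ∈ K t ω := by
  obtain ⟨X, hXm, hX⟩ := hK.generated
  -- Since `K t ω` is closed, membership means approximability by finite combinations whose
  -- coefficients come from a countable dense family.
  let q : ℕ → ℕ → NNReal := TopologicalSpace.denseSeq (ℕ → NNReal)
  refine ⟨{ω | ∀ k : ℕ, ∃ M j : ℕ,
    dist (y ω) (∑ i ∈ Finset.range M, (q j i : ℝ) • X i t ω) < 1 / ((k : ℝ) + 1)}, ?_, ?_⟩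
  · simp only [ofPred_forall, ofPred_exists]
    refine MeasurableSet.iInter fun k => MeasurableSet.iUnion fun M => MeasurableSet.iUnion fun j =>
      ?_
    have hs : Measurable[ℱ t] fun ω => ∑ i ∈ Finset.range M, (q j i : ℝ) • X i t ω :=
      Finset.measurable_fun_sum _ fun i _ => (hXm i t ht).const_smul (q j i : ℝ)
    exact measurableSet_dist_lt hy hs
  · filter_upwards [hX t ht] with ω hω
    obtain ⟨hfin, -, heq⟩ := hω
    have hcl : IsClosed (K t ω) := by rw [heq]; exact isClosed_hull_range hfin
    constructor
    · intro h
      rw [← hcl.closure_eq, Metric.mem_closure_iff]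
      intro ε hε
      obtain ⟨k, hk⟩ := exists_nat_one_div_lt hε
      obtain ⟨M, j, hj⟩ := h k
      refine ⟨_, ?_, hj.trans hk⟩
      rw [heq]
      exact sum_mem fun i _ => (PointedCone.hull ℝ _).smul_mem (q j i).2
        (PointedCone.subset_hull (mem_range_self i))
    · intro h k
      rw [heq, SetLike.mem_coe, Finsupp.mem_span_range_iff_exists_finsupp] at h
      obtain ⟨c, hc⟩ := h
      obtain ⟨M, hM⟩ : ∃ M, c.support ⊆ Finset.range M := Finset.exists_nat_subset_range _
      rw [Finsupp.sum_of_support_subset c hM _ (by simp)] at hc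
      let f : (ℕ → NNReal) → Portfolio d N := fun c => ∑ i ∈ Finset.range M, (c i : ℝ) • X i t ω
      have hf : Continuous f := by fun_prop
      have hfc : f (fun i => c i) = y ω := hc
      have ho : IsOpen {c | dist (y ω) (f c) < 1 / ((k : ℝ) + 1)} :=
        isOpen_lt (by fun_prop) continuous_const
      obtain ⟨j, hj⟩ := (TopologicalSpace.denseRange_denseSeq (ℕ → NNReal)).exists_mem_open ho
        ⟨fun i => c i, by
          change dist (y ω) (f fun i => c i) < _
          rw [hfc, dist_self]
          positivity⟩
      exact ⟨M, j, hj⟩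

end Model

/-! ### Measurable selection of random subsequences. -/

section RandomIndex

variable {Ω : Type*} {m' : MeasurableSpace Ω}

theorem measurable_apply_index {E : Type*} [MeasurableSpace E] {f : ℕ → Ω → E}
    (hf : ∀ n, Measurable (f n)) {τ : Ω → ℕ} (hτ : Measurable τ) :
    Measurable fun ω => f (τ ω) ω := by
  intro S hS
  have : (fun ω => f (τ ω) ω) ⁻¹' S = ⋃ n, τ ⁻¹' {n} ∩ f n ⁻¹' S := by
    ext ω
    simp
  rw [this]
  exact MeasurableSet.iUnion fun n => (hτ (measurableSet_singleton n)).inter (hf n hS)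

theorem exists_measurable_index {p : ℕ → Ω → Prop} (hm : ∀ n, MeasurableSet {ω | p n ω})
    (h : ∀ ω, ∃ᶠ n in atTop, p n ω) (k : ℕ) :
    ∃ τ : Ω → ℕ, Measurable τ ∧ ∀ ω, k ≤ τ ω ∧ p (τ ω) ω := by
  classical
  have h' : ∀ ω, ∃ n, k ≤ n ∧ p n ω := fun ω => by
    obtain ⟨n, hn, hp⟩ := frequently_atTop.1 (h ω) k
    exact ⟨n, hn, hp⟩
  refine ⟨fun ω => Nat.find (h' ω), measurable_find h' fun n => ?_, fun ω => Nat.find_spec (h' ω)⟩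
  by_cases hn : k ≤ n
  · simpa [hn] using hm n
  · simp [hn]

/-- A sequence of random variables bounded at each `ω` converges along a random subsequence. -/
theorem exists_random_subsequence_real {f : ℕ → Ω → ℝ} (hf : ∀ n, Measurable (f n))
    (hb : ∀ ω, ∃ M, ∀ n, |f n ω| ≤ M) :
    ∃ τ : ℕ → Ω → ℕ, (∀ k, Measurable (τ k)) ∧ (∀ k ω, k ≤ τ k ω) ∧
      ∃ l : Ω → ℝ, Measurable l ∧ ∀ ω, Tendsto (fun k => f (τ k ω) ω) atTop (𝓝 (l ω)) := by
  have hl : Measurable fun ω => liminf (fun n => f n ω) atTop := Measurable.liminf hf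
  set l : Ω → ℝ := fun ω => liminf (fun n => f n ω) atTop with hldef
  have hfreq : ∀ k : ℕ, ∀ ω, ∃ᶠ n in atTop, dist (f n ω) (l ω) < 1 / ((k : ℝ) + 1) := by
    intro k ω
    obtain ⟨M, hM⟩ := hb ω
    have hε : (0 : ℝ) < 1 / ((k : ℝ) + 1) := by positivity
    have hbelow : IsBoundedUnder (· ≥ ·) atTop fun n => f n ω :=
      isBoundedUnder_of ⟨-M, fun n => (abs_le.1 (hM n)).1⟩
    have habove : IsBoundedUnder (· ≤ ·) atTop fun n => f n ω :=
      isBoundedUnder_of ⟨M, fun n => (abs_le.1 (hM n)).2⟩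
    have h1 := frequently_lt_of_liminf_lt (f := atTop) (u := fun n => f n ω)
      (b := l ω + 1 / ((k : ℝ) + 1)) habove.isCoboundedUnder_ge (lt_add_of_pos_right _ hε)
    have h2 := eventually_lt_of_lt_liminf (f := atTop) (u := fun n => f n ω)
      (b := l ω - 1 / ((k : ℝ) + 1)) (sub_lt_self _ hε) hbelow
    refine (h1.and_eventually h2).mono fun n hn => ?_
    rw [Real.dist_eq, abs_lt]
    constructor <;> linarith [hn.1, hn.2]
  -- The first index past `k` that comes close to the lower limit. Monotonicity in `k` is not
  -- needed: `k ≤ τ k ω` already makes the indices tend to infinity.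
  choose τ hτm hτ using fun k : ℕ => exists_measurable_index
    (fun n => measurableSet_dist_lt (hf n) hl) (hfreq k) k
  refine ⟨τ, hτm, fun k ω => (hτ k ω).1, l, hl, fun ω => ?_⟩
  rw [tendsto_iff_dist_tendsto_zero]
  exact squeeze_zero (fun _ => dist_nonneg) (fun k => (hτ k ω).2.le)
    tendsto_one_div_add_atTop_nhds_zero_nat

/-- Bolzano–Weierstrass one coordinate at a time: a further extraction preserves the limits already
obtained. -/
theorem exists_random_subsequence_family {ι : Type*} (s : Finset ι) {f : ι → ℕ → Ω → ℝ}
    (hf : ∀ i n, Measurable (f i n)) (hb : ∀ i ω, ∃ M, ∀ n, |f i n ω| ≤ M) :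
    ∃ τ : ℕ → Ω → ℕ, (∀ k, Measurable (τ k)) ∧ (∀ k ω, k ≤ τ k ω) ∧
      ∀ i ∈ s, ∃ l : Ω → ℝ, Measurable l ∧
        ∀ ω, Tendsto (fun k => f i (τ k ω) ω) atTop (𝓝 (l ω)) := by
  classical
  induction s using Finset.induction_on with
  | empty => exact ⟨fun k _ => k, fun _ => measurable_const, fun _ _ => le_rfl, by simp⟩
  | insert j s _ ih =>
    obtain ⟨τ, hτm, hτ, hlim⟩ := ih
    obtain ⟨σ, hσm, hσ, l, hl, hσl⟩ := exists_random_subsequence_real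
      (f := fun k ω => f j (τ k ω) ω) (fun k => measurable_apply_index (hf j) (hτm k))
      (fun ω => (hb j ω).imp fun M hM n => hM _)
    refine ⟨fun k ω => τ (σ k ω) ω, fun k => measurable_apply_index hτm (hσm k),
      fun k ω => (hσ k ω).trans (hτ _ ω), fun i hi => ?_⟩
    rcases Finset.mem_insert.1 hi with rfl | hi
    · exact ⟨l, hl, hσl⟩
    · obtain ⟨l', hl', h⟩ := hlim i hi
      exact ⟨l', hl', fun ω => (h ω).comp (tendsto_atTop_mono (hσ · ω) tendsto_id)⟩

theorem exists_random_subsequence_of_bounded {d N : ℕ} {f : ℕ → Ω → Portfolio d N}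
    (hf : ∀ n, Measurable (f n)) (hb : ∀ ω, ∃ M : ℝ, ∀ n, ‖f n ω‖ ≤ M) :
    ∃ τ : ℕ → Ω → ℕ, (∀ k, Measurable (τ k)) ∧ (∀ k ω, k ≤ τ k ω) ∧
      ∃ l : Ω → Portfolio d N, Measurable l ∧
        ∀ ω, Tendsto (fun k => f (τ k ω) ω) atTop (𝓝 (l ω)) := by
  obtain ⟨τ, hτm, hτ, h⟩ := exists_random_subsequence_family Finset.univ
    (f := fun (i : Fin d ⊕ Fin N) n ω => Sum.elim (f n ω).1 (f n ω).2 i) (by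
      rintro (i | i) n
      · exact (measurable_pi_apply i).comp (hf n).fst
      · exact (measurable_pi_apply i).comp (hf n).snd) (by
      rintro i ω
      obtain ⟨M, hM⟩ := hb ω
      refine ⟨M, fun n => ?_⟩
      rcases i with i | i
      · exact (norm_le_pi_norm (f n ω).1 i).trans ((norm_fst_le _).trans (hM n))
      · exact (norm_le_pi_norm (f n ω).2 i).trans ((norm_snd_le _).trans (hM n)))
  choose l hlm hl using fun i => h i (Finset.mem_univ i)
  refine ⟨τ, hτm, hτ, fun ω => (fun i => l (.inl i) ω, fun i => l (.inr i) ω), ?_, fun ω => ?_⟩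
  · exact (measurable_pi_lambda _ fun i => hlm _).prodMk (measurable_pi_lambda _ fun i => hlm _)
  · refine Tendsto.prodMk_nhds (f := atTop) (tendsto_pi_nhds.2 fun i => ?_)
      (tendsto_pi_nhds.2 fun i => ?_)
    · exact hl (.inl i) ω
    · exact hl (.inr i) ω

/-- A sequence of random vectors whose norms do not tend to infinity converges along a random
subsequence. -/
theorem exists_random_subsequence {d N : ℕ} {f : ℕ → Ω → Portfolio d N}
    (hf : ∀ n, Measurable (f n)) (hb : ∀ ω, ∃ M : ℕ, ∃ᶠ n in atTop, ‖f n ω‖ ≤ M) :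
    ∃ τ : ℕ → Ω → ℕ, (∀ k, Measurable (τ k)) ∧ (∀ k ω, k ≤ τ k ω) ∧
      ∃ l : Ω → Portfolio d N, Measurable l ∧
        ∀ ω, Tendsto (fun k => f (τ k ω) ω) atTop (𝓝 (l ω)) := by
  classical
  have hle : ∀ {g : Ω → ℝ}, Measurable g → ∀ n, MeasurableSet {ω | ‖f n ω‖ ≤ g ω} :=
    fun hg n => measurableSet_le (hf n).norm hg
  -- The least integer bounding infinitely many of the norms is a measurable function of `ω`, so the
  -- terms below it can be selected measurably.
  have hM : Measurable fun ω => Nat.find (hb ω) := measurable_find hb fun M => by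
    simp only [frequently_atTop, ofPred_forall, ofPred_exists]
    refine MeasurableSet.iInter fun a => MeasurableSet.iUnion fun b => ?_
    by_cases hab : a ≤ b
    · simpa [hab] using hle measurable_const b
    · simp [hab]
  choose τ hτm hτ using fun k : ℕ => exists_measurable_index
    (hle ((measurable_from_top (f := fun n : ℕ => (n : ℝ))).comp hM))
    (fun ω => Nat.find_spec (hb ω)) k
  obtain ⟨σ, hσm, hσ, l, hl, hlim⟩ := exists_random_subsequence_of_bounded
    (f := fun k ω => f (τ k ω) ω) (fun k => measurable_apply_index hf (hτm k))
    (fun ω => ⟨_, fun k => (hτ k ω).2⟩)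
  exact ⟨fun k ω => τ (σ k ω) ω, fun k => measurable_apply_index hτm (hσm k),
    fun k ω => (hσ k ω).trans (hτ _ ω).1, l, hl, hlim⟩

/-- Gives limits that exist only almost surely a version measurable for the given σ-algebra, without
completing it. -/
theorem exists_measurable_limit {d N : ℕ} {f : ℕ → Ω → Portfolio d N}
    (hf : ∀ n, Measurable (f n)) : ∃ g : Ω → Portfolio d N, Measurable g ∧
      ∀ ω x, Tendsto (fun n => f n ω) atTop (𝓝 x) → g ω = x :=
  ⟨_, (StronglyMeasurable.limUnder (l := atTop) fun n => (hf n).stronglyMeasurable).measurable,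
    fun _ _ h => h.limUnder_eq⟩

end RandomIndex

/-! ### Return maps at random arguments and under scaling. -/

section ReturnMaps

variable {Ω : Type*} {m : MeasurableSpace Ω} {μ : Measure Ω} {ℱ : Filtration ℕ m} {T d N : ℕ}
  {K : ℕ → Ω → Set (Portfolio d N)} {R : ℕ → Ω → (Fin N → ℝ) → Portfolio d N}

/-- The return maps, being adapted and continuous, are adapted at random arguments. -/
theorem IsReturnProcess.isRandomMap (hR : IsReturnProcess ℱ T R) (hR1 : CondR1 μ T R) :
    IsRandomMap μ ℱ T R := by
  intro t ht α hα hα0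
  have hcont : Continuous fun x : Fin N → ℝ => x ⊔ 0 :=
    continuous_pi fun i => (continuous_apply i).sup continuous_const
  have h0 : (0 : Fin N → ℝ) ∈ {x : Fin N → ℝ | 0 ≤ x} := le_refl (0 : Fin N → ℝ)
  have hβ : Measurable[ℱ t] fun ω => α ω ⊔ 0 := 
    hcont.measurable.comp hα
  let a : ℕ → @SimpleFunc Ω (ℱ t) (Fin N → ℝ) := fun n =>
    @SimpleFunc.approxOn (Fin N → ℝ) Ω _ _ _ (ℱ t) _ hβ {x | 0 ≤ x} 0 h0 _ n
  have ha : ∀ n, Measurable[ℱ t] fun ω => R t ω (a n ω ⊔ 0) := fun n =>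
    @SimpleFunc.measurable_bind Ω _ _ (ℱ t) _ (a n) (fun b ω => R t ω (b ⊔ 0))
      fun b => hR.adapted t ht _ le_sup_right
  obtain ⟨g, hg, hlim⟩ := exists_measurable_limit ha
  refine ⟨g, hg.stronglyMeasurable, ?_⟩
  filter_upwards [hR1 t ht, hα0] with ω hω hω0
  have h1 : Tendsto (fun n => a n ω) atTop (𝓝 (α ω ⊔ 0)) :=
    @SimpleFunc.tendsto_approxOn (Fin N → ℝ) Ω _ _ _ (ℱ t) _ hβ {x | 0 ≤ x} 0 h0 _ ω
      (subset_closure (show 0 ≤ α ω ⊔ 0 from le_sup_right))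
  have h2 : Tendsto (fun n => a n ω ⊔ 0) atTop (𝓝 (α ω)) := by
    simpa [sup_eq_left.2 hω0, Function.comp_def] using (hcont.tendsto _).comp h1
  exact (hlim _ _ ((hω.2 (α ω) hω0).tendsto.comp
    (tendsto_nhdsWithin_iff.2 ⟨h2, Eventually.of_forall fun n =>
      show 0 ≤ a n ω ⊔ 0 from le_sup_right⟩))).symm

/-- Under concavity, scaling down the investment costs no return, up to a financial transaction. -/
theorem CondR2.ae_sub_smul_mem (hR2 : CondR2 μ T K R) (hR1 : CondR1 μ T R)
    (hK : IsSolvencyProcess μ ℱ T K) :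
    ∀ᵐ ω ∂μ, ∀ t ≤ T, ∀ c : ℝ, 0 ≤ c → c ≤ 1 → ∀ x : Fin N → ℝ, 0 ≤ x →
      R t ω (c • x) - c • R t ω x ∈ K t ω := by
  rw [ae_all_iff]
  intro t
  by_cases ht : t ≤ T
  swap
  · exact ae_of_all _ fun ω h => absurd h ht
  let q : ℕ → Icc (0 : ℝ) 1 × {x : Fin N → ℝ // 0 ≤ x} := TopologicalSpace.denseSeq _
  have hq : ∀ᵐ ω ∂μ, ∀ n, -((q n).1.1 • R t ω (q n).2.1 + (1 - (q n).1.1) • R t ω 0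
      - R t ω ((q n).1.1 • (q n).2.1 + (1 - (q n).1.1) • 0)) ∈ financial (K t ω) :=
    ae_all_iff.2 fun n => hR2 t ht (q n).1.1 (q n).1.2.1 (q n).1.2.2 (fun _ => (q n).2.1)
      (fun _ => 0) measurable_const measurable_const (ae_of_all _ fun _ => (q n).2.2)
      (ae_of_all _ fun _ => le_rfl)
  filter_upwards [hq, hR1 t ht, hK.ae_isSolvencyCone] with ω h1 h2 h3 _ c hc0 hc1 x hx
  let φ : Icc (0 : ℝ) 1 × {x : Fin N → ℝ // 0 ≤ x} → Portfolio d N :=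
    fun p => R t ω (p.1.1 • p.2.1) - p.1.1 • R t ω p.2.1
  have hφ : Continuous φ := by
    have e1 : Continuous fun p : Icc (0 : ℝ) 1 × {x : Fin N → ℝ // 0 ≤ x} =>
        R t ω (p.1.1 • p.2.1) :=
      h2.2.comp_continuous (by fun_prop) fun p => smul_nonneg p.1.2.1 p.2.2
    have e2 : Continuous fun p : Icc (0 : ℝ) 1 × {x : Fin N → ℝ // 0 ≤ x} => R t ω p.2.1 :=
      h2.2.comp_continuous (by fun_prop) fun p => p.2.2
    exact e1.sub ((continuous_subtype_val.comp continuous_fst).smul e2)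
  have hcl : IsClosed (φ ⁻¹' K t ω) := (h3 t ht).isClosed.preimage hφ
  have hd : DenseRange q := TopologicalSpace.denseRange_denseSeq _
  exact hd.induction_on (p := fun p => φ p ∈ K t ω) (⟨c, hc0, hc1⟩, ⟨x, hx⟩) hcl fun n => by
    have := (h1 n).1
    simpa [h2.1, φ] using this

end ReturnMaps

/-! ### Feasible paths for a fixed scenario. -/

section Paths

variable {d N : ℕ}

/-- The industrial holding at date `s` along a path of transfers, starting from `a`. -/
def holdings (x : ℕ → Portfolio d N) (a : Fin N → ℝ) (s : ℕ) : Fin N → ℝ :=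
  ∑ u ∈ Finset.range (s + 1), (x u).2 + a

/-- A path of transfers from date `t` on which is compatible with the solvency cones `F`, starts from
the industrial holding `a` and ends with the wealth `g`. -/
structure IsFeasiblePath (T : ℕ) (F : ℕ → Set (Portfolio d N))
    (r : ℕ → (Fin N → ℝ) → Portfolio d N) (t : ℕ) (x : ℕ → Portfolio d N) (a : Fin N → ℝ)
    (g : Portfolio d N) : Prop where
  zero_of_lt : ∀ s < t, x s = 0
  neg_mem : ∀ s, t ≤ s → s ≤ T → -x s ∈ F s
  nonneg : ∀ s, t ≤ s → s < T → 0 ≤ holdings x a s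
  wealth : ∑ s ∈ Finset.Icc t T, x s + ∑ s ∈ Finset.Ico t T, r (s + 1) (holdings x a s) = g

variable {T t : ℕ} {F : ℕ → Set (Portfolio d N)} {r : ℕ → (Fin N → ℝ) → Portfolio d N}
  {x : ℕ → Portfolio d N} {a : Fin N → ℝ} {g : Portfolio d N}

theorem holdings_of_eq_zero {s : ℕ} (h : ∀ u ≤ s, (x u).2 = 0) : holdings x a s = a := by
  rw [holdings, Finset.sum_eq_zero fun u hu => h u (Nat.lt_succ_iff.1 (Finset.mem_range.1 hu)),
    zero_add]

theorem holdings_succ (s : ℕ) : holdings x a (s + 1) = holdings x a s + (x (s + 1)).2 := by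
  simp only [holdings, Finset.sum_range_succ _ (s + 1)]
  abel

theorem sum_Icc_eq_add_sum_Ico_succ {M : Type*} [AddCommMonoid M] (f : ℕ → M) (h : t ≤ T) :
    ∑ s ∈ Finset.Icc t T, f s = f t + ∑ s ∈ Finset.Ico t T, f (s + 1) := by
  rw [Finset.sum_Ico_add' f t T 1, ← Finset.sum_eq_sum_Ico_succ_bot (Nat.lt_succ_of_le h)]
  rfl

theorem isFeasiblePath_zero (hF : ∀ s ≤ T, IsSolvencyCone (F s)) (hr : ∀ s ≤ T, r s 0 = 0) :
    IsFeasiblePath T F r t 0 0 0 := by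
  have h0 : ∀ s, holdings (0 : ℕ → Portfolio d N) 0 s = 0 := fun s =>
    holdings_of_eq_zero fun _ _ => rfl
  refine ⟨fun _ _ => rfl, fun s _ hs => ?_, fun s _ _ => (h0 s).ge, ?_⟩
  · simpa using (hF s hs).zero_mem
  · simp only [h0, Pi.zero_apply, Finset.sum_const_zero, zero_add]
    exact Finset.sum_eq_zero fun s hs => hr _ (Finset.mem_Ico.1 hs).2

theorem holdings_update {η : Portfolio d N} (hx : x t = 0) {s : ℕ} (hs : t ≤ s) :
    holdings (Function.update x t η) a s = holdings x (η.2 + a) s := by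
  have h : ∀ u, (Function.update x t η u).2 = (x u).2 + if u = t then η.2 else 0 := by
    intro u
    by_cases hu : u = t
    · subst hu
      simp [hx]
    · simp [hu]
  simp only [holdings, h, Finset.sum_add_distrib, Finset.sum_ite_eq', Finset.mem_range,
    Nat.lt_succ_iff, hs, if_true]
  abel

/-- The dynamic programming principle behind the backward induction: after the first transfer, its
holding is the initial datum at `t + 1`, and the wealth still to be reached is reduced by the
transfer and by the return it earns. -/
theorem isFeasiblePath_update_iff (ht : t < T) {η : Portfolio d N} (hx : ∀ s ≤ t, x s = 0) :
    IsFeasiblePath T F r t (Function.update x t η) a g ↔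
      -η ∈ F t ∧ 0 ≤ η.2 + a ∧
        IsFeasiblePath T F r (t + 1) x (η.2 + a) (g - η - r (t + 1) (η.2 + a)) := by
  have hne : ∀ s, s ≠ t → Function.update x t η s = x s := fun s hs => by simp [hs]
  have hold : ∀ s, t ≤ s → holdings (Function.update x t η) a s = holdings x (η.2 + a) s :=
    fun s hs => holdings_update (hx t le_rfl) hs
  have hold0 : holdings x (η.2 + a) t = η.2 + a :=
    holdings_of_eq_zero fun u hu => by rw [hx u hu]; rfl
  have hsum : ∑ s ∈ Finset.Icc t T, Function.update x t η s
      = η + ∑ s ∈ Finset.Icc (t + 1) T, x s := by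
    rw [sum_Icc_eq_add_sum_Ico_succ _ ht.le, Function.update_self, Finset.sum_Ico_add' _ t T 1]
    congr 1
    refine Finset.sum_congr rfl fun s hs => hne s ?_
    have := (Finset.mem_Ico.1 hs).1
    lia
  have hsum' : ∑ s ∈ Finset.Ico t T, r (s + 1) (holdings (Function.update x t η) a s)
      = r (t + 1) (η.2 + a) + ∑ s ∈ Finset.Ico (t + 1) T, r (s + 1) (holdings x (η.2 + a) s) := by
    rw [Finset.sum_eq_sum_Ico_succ_bot ht, hold t le_rfl, hold0]
    congr 1
    refine Finset.sum_congr rfl fun s hs => ?_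
    rw [hold s (Nat.le_of_succ_le (Finset.mem_Ico.1 hs).1)]
  constructor
  · intro h
    refine ⟨by simpa using h.neg_mem t le_rfl ht.le, ?_, ?_⟩
    · have := h.nonneg t le_rfl ht
      rwa [hold t le_rfl, hold0] at this
    · refine ⟨fun s hs => hx s (Nat.lt_succ_iff.1 hs), fun s hs hsT => ?_, fun s hs hsT => ?_, ?_⟩
      · have := h.neg_mem s (Nat.le_of_succ_le hs) hsT
        rwa [hne s (by lia)] at this
      · have := h.nonneg s (Nat.le_of_succ_le hs) hsT
        rwa [hold s (Nat.le_of_succ_le hs)] at this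
      · have := h.wealth
        rw [hsum, hsum'] at this
        rw [← this]
        abel
  · rintro ⟨h1, h2, h⟩
    refine ⟨fun s hs => ?_, fun s hs hsT => ?_, fun s hs hsT => ?_, ?_⟩
    · rw [hne s hs.ne, hx s hs.le]
    · rcases hs.eq_or_lt with rfl | hs
      · simpa using h1
      · rw [hne s hs.ne']
        exact h.neg_mem s hs hsT
    · rw [hold s hs]
      rcases hs.eq_or_lt with rfl | hs
      · rwa [hold0]
      · exact h.nonneg s hs hsT
    · rw [hsum, hsum']
      have := h.wealth
      rw [sub_sub, eq_sub_iff_add_eq] at this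
      rw [← this]
      abel

/-- Scaling a path by `c`, and replacing the return maps by others whose additional returns `κ` are
given up by financial transfers. -/
theorem IsFeasiblePath.smul_sub {F' : ℕ → Set (Portfolio d N)}
    {r' : ℕ → (Fin N → ℝ) → Portfolio d N} (h : IsFeasiblePath T F r t x a g) (ht : t ≤ T)
    {c : ℝ} (hc : 0 ≤ c) {κ : ℕ → Portfolio d N} (hκ0 : ∀ s ≤ t, κ s = 0)
    (hκ : ∀ s, t ≤ s → s < T →
      κ (s + 1) = r' (s + 1) (c • holdings x a s) - c • r (s + 1) (holdings x a s))
    (hκ2 : ∀ s ≤ T, (κ s).2 = 0)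
    (hF' : ∀ s, t ≤ s → s ≤ T → -(c • x s - κ s) ∈ F' s) :
    IsFeasiblePath T F' r' t (fun s => c • x s - κ s) (c • a) (c • g) := by
  have hold : ∀ s ≤ T, holdings (fun s => c • x s - κ s) (c • a) s = c • holdings x a s := by
    intro s hs
    simp only [holdings, smul_add, Finset.smul_sum]
    congr 1
    refine Finset.sum_congr rfl fun u hu => ?_
    simp [hκ2 u ((Nat.lt_succ_iff.1 (Finset.mem_range.1 hu)).trans hs)]
  refine ⟨fun s hs => ?_, hF', fun s hs hsT => ?_, ?_⟩
  · simp [h.zero_of_lt s hs, hκ0 s hs.le]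
  · rw [hold s hsT.le]
    exact smul_nonneg hc (h.nonneg s hs hsT)
  · rw [← h.wealth, Finset.sum_sub_distrib, sum_Icc_eq_add_sum_Ico_succ κ ht, hκ0 t le_rfl,
      zero_add, sub_add, ← Finset.sum_sub_distrib, smul_add, ← Finset.smul_sum, sub_eq_add_neg,
      ← Finset.sum_neg_distrib, Finset.smul_sum (s := Finset.Ico t T)]
    congr 1
    refine Finset.sum_congr rfl fun s hs => ?_
    obtain ⟨h1, h2⟩ := Finset.mem_Ico.1 hs
    rw [hold s h2.le, hκ s h1 h2]
    abel

/-- Adding multiples of a reversible financial path with zero wealth. -/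
theorem IsFeasiblePath.sub_smul (h : IsFeasiblePath T F r t x a g)
    (hF : ∀ s ≤ T, IsSolvencyCone (F s)) {z : ℕ → Portfolio d N} (hz0 : ∀ s < t, z s = 0)
    (hz : ∀ s ≤ T, z s ∈ lineality (financial (F s))) (hsum : ∑ s ∈ Finset.Icc t T, z s = 0)
    (b : ℝ) : IsFeasiblePath T F r t (fun s => x s - b • z s) a g := by
  have hold : ∀ s ≤ T, holdings (fun s => x s - b • z s) a s = holdings x a s := by
    intro s hs
    simp only [holdings]
    congr 1
    refine Finset.sum_congr rfl fun u hu => ?_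
    simp [(hz u ((Nat.lt_succ_iff.1 (Finset.mem_range.1 hu)).trans hs)).1.2]
  refine ⟨fun s hs => ?_, fun s hs hsT => ?_, fun s hs hsT => ?_, ?_⟩
  · simp [h.zero_of_lt s hs, hz0 s hs]
  · have := (hF s hsT).add_mem (h.neg_mem s hs hsT) ((hF s hsT).smul_lineality b (hz s hsT))
    convert! this using 1
    abel
  · rw [hold s hsT.le]
    exact h.nonneg s hs hsT
  · rw [Finset.sum_sub_distrib, ← Finset.smul_sum, hsum, smul_zero, sub_zero, ← h.wealth]
    congr 1
    refine Finset.sum_congr rfl fun s hs => ?_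
    rw [hold s (Finset.mem_Ico.1 hs).2.le]

/-- Returns are financial, so only transfers move the industrial component. This controls the
holding at `T`, on which feasibility imposes no sign. -/
theorem IsFeasiblePath.snd_wealth (h : IsFeasiblePath T F r t x a g)
    (hr : ∀ s ≤ T, ∀ y, 0 ≤ y → (r s y).2 = 0) : holdings x a T = g.2 + a := by
  have h2 : (∑ s ∈ Finset.Ico t T, r (s + 1) (holdings x a s)).2 = 0 := by
    rw [Prod.snd_sum]
    refine Finset.sum_eq_zero fun s hs => ?_
    obtain ⟨h1, h2⟩ := Finset.mem_Ico.1 hs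
    exact hr _ h2 _ (h.nonneg s h1 h2)
  rw [← h.wealth, Prod.snd_add, h2, add_zero, holdings, Prod.snd_sum]
  congr 1
  symm
  refine Finset.sum_subset (fun s hs => ?_) fun s _ hs => ?_
  · have := (Finset.mem_Icc.1 hs).2
    simp only [Finset.mem_range]
    lia
  · simp only [Finset.mem_range, Finset.mem_Icc, not_and, not_le] at *
    rw [h.zero_of_lt s (by lia)]
    rfl

/-- A path with no initial holding and no wealth may be started earlier. -/
theorem IsFeasiblePath.start_zero (h : IsFeasiblePath T F r t x 0 g)
    (hF : ∀ s ≤ T, IsSolvencyCone (F s)) (hr : ∀ s ≤ T, r s 0 = 0) :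
    IsFeasiblePath T F r 0 x 0 g := by
  have hold : ∀ s < t, holdings x 0 s = 0 := fun s hs =>
    holdings_of_eq_zero fun u hu => by rw [h.zero_of_lt u (hu.trans_lt hs)]; rfl
  refine ⟨fun s hs => absurd hs (Nat.not_lt_zero s), fun s _ hsT => ?_, fun s _ hsT => ?_, ?_⟩
  · rcases lt_or_ge s t with hs | hs
    · simpa [h.zero_of_lt s hs] using (hF s hsT).zero_mem
    · exact h.neg_mem s hs hsT
  · rcases lt_or_ge s t with hs | hs
    · exact (hold s hs).ge
    · exact h.nonneg s hs hsT
  · rw [← h.wealth]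
    congr 1
    · symm
      refine Finset.sum_subset (Finset.Icc_subset_Icc_left (Nat.zero_le t)) fun s h1 h2 => ?_
      simp only [Finset.mem_Icc, not_and, not_le] at h1 h2
      exact h.zero_of_lt s (by lia)
    · symm
      refine Finset.sum_subset (Finset.Ico_subset_Ico_left (Nat.zero_le t)) fun s h1 h2 => ?_
      simp only [Finset.mem_Ico, not_and, not_lt] at h1 h2
      rw [hold s (by lia), hr (s + 1) h1.2]

end Paths

/-! ### Adaptedness of holdings and of returns along a strategy. -/

section Model

variable {Ω : Type*} {m : MeasurableSpace Ω} {d N : ℕ}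

theorem measurable_holdings {ℱ : Filtration ℕ m} {t s T : ℕ} {ξ : ℕ → Ω → Portfolio d N}
    {α : Ω → Fin N → ℝ} (hξ : ∀ s ≤ T, Measurable[ℱ s] (ξ s)) (hα : Measurable[ℱ t] α)
    (hts : t ≤ s) (hs : s ≤ T) :
    Measurable[ℱ s] fun ω => holdings (fun u => ξ u ω) (α ω) s := by
  have h : ∀ u ∈ Finset.range (s + 1), Measurable[ℱ s] fun ω => (ξ u ω).2 := fun u hu => by
    have hu' := Nat.lt_succ_iff.1 (Finset.mem_range.1 hu)
    exact measurable_snd.comp ((hξ u (hu'.trans hs)).mono (ℱ.mono hu') le_rfl)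
  exact (Finset.measurable_fun_sum _ h).add (hα.mono (ℱ.mono hts) le_rfl)

/-- Differences of random returns along a strategy have adapted versions. -/
theorem exists_adapted_sub_smul {μ : Measure Ω} {ℱ : Filtration ℕ m} {T t : ℕ}
    {R R' : ℕ → Ω → (Fin N → ℝ) → Portfolio d N} (hR : IsRandomMap μ ℱ T R)
    (hR' : IsRandomMap μ ℱ T R') {ξ : ℕ → Ω → Portfolio d N} {α : Ω → Fin N → ℝ} {c : Ω → ℝ}
    (hξ : ∀ s ≤ T, Measurable[ℱ s] (ξ s)) (hα : Measurable[ℱ t] α) (hc : Measurable[ℱ t] c)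
    (hc0 : ∀ ω, 0 ≤ c ω)
    (h0 : ∀ᵐ ω ∂μ, ∀ s, t ≤ s → s < T → 0 ≤ holdings (fun u => ξ u ω) (α ω) s) :
    ∃ κ : ℕ → Ω → Portfolio d N, (∀ s ≤ T, Measurable[ℱ s] (κ s)) ∧ (∀ s ≤ t, ∀ ω, κ s ω = 0) ∧
      ∀ᵐ ω ∂μ, ∀ s, t ≤ s → s < T → κ (s + 1) ω
        = R' (s + 1) ω (c ω • holdings (fun u => ξ u ω) (α ω) s)
          - c ω • R (s + 1) ω (holdings (fun u => ξ u ω) (α ω) s) := by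
  have key : ∀ s, ∃ k : Ω → Portfolio d N, t ≤ s → s < T → Measurable[ℱ (s + 1)] k ∧
      ∀ᵐ ω ∂μ, k ω = R' (s + 1) ω (c ω • holdings (fun u => ξ u ω) (α ω) s)
          - c ω • R (s + 1) ω (holdings (fun u => ξ u ω) (α ω) s) := by
    intro s
    by_cases hs : t ≤ s ∧ s < T
    swap
    · exact ⟨0, fun h1 h2 => absurd ⟨h1, h2⟩ hs⟩
    obtain ⟨hts, hsT⟩ := hs
    have hle := ℱ.mono (Nat.le_succ s)
    have hm : Measurable[ℱ (s + 1)] fun ω => holdings (fun u => ξ u ω) (α ω) s :=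
      (measurable_holdings hξ hα hts hsT.le).mono hle le_rfl
    have hcm : Measurable[ℱ (s + 1)] c := hc.mono ((ℱ.mono hts).trans hle) le_rfl
    have h0' : ∀ᵐ ω ∂μ, 0 ≤ holdings (fun u => ξ u ω) (α ω) s := by
      filter_upwards [h0] with ω hω
      exact hω s hts hsT
    obtain ⟨g, hg, hgR⟩ := hR (s + 1) hsT _ hm h0'
    obtain ⟨g', hg', hgR'⟩ := hR' (s + 1) hsT _ (hcm.smul hm) (by
      filter_upwards [h0'] with ω hω
      exact smul_nonneg (hc0 ω) hω)
    refine ⟨fun ω => g' ω - c ω • g ω, fun _ _ => ⟨?_, ?_⟩⟩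
    · exact hg'.measurable.sub (hcm.smul hg.measurable)
    · filter_upwards [hgR, hgR'] with ω h1 h2
      rw [← h1, ← h2]
      rfl
  choose k hk using key
  -- The return on the holding of date `s - 1` is paid at date `s`, hence the shift and the
  -- vanishing up to `t`.
  refine ⟨fun s => if t < s ∧ s ≤ T then k (s - 1) else 0, fun s hs => ?_, fun s hs ω => ?_, ?_⟩
  · dsimp only
    split_ifs with h
    · have := (hk (s - 1) (by lia) (by lia)).1
      rwa [Nat.sub_add_cancel (by lia)] at this
    · exact measurable_const
  · simp [Nat.not_lt.2 hs]
  · rw [ae_all_iff]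
    intro s
    by_cases hs : t ≤ s ∧ s < T
    swap
    · exact ae_of_all _ fun ω h1 h2 => absurd ⟨h1, h2⟩ hs
    filter_upwards [(hk s hs.1 hs.2).2] with ω hω _ _
    rw [← hω, if_pos ⟨Nat.lt_succ_of_le hs.1, hs.2⟩]
    rfl

end Model

/-! ### Consequences of robust no-arbitrage. -/

section Arbitrage

variable {Ω : Type*} {m : MeasurableSpace Ω} {μ : Measure Ω} {ℱ : Filtration ℕ m} {T d N : ℕ}
  {K K' : ℕ → Ω → Set (Portfolio d N)} {R R' : ℕ → Ω → (Fin N → ℝ) → Portfolio d N}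

/-- Without arbitrage, a strategy that replicates zero never leaves anything on the table. -/
theorem NoArbitrage.ae_neg_notMem_interior (hNA : NoArbitrage μ ℱ T K R)
    (hK : IsSolvencyProcess μ ℱ T K) (hR : IsReturnProcess ℱ T R) (hd : 1 ≤ d)
    {ξ : ℕ → Ω → Portfolio d N} (hξ : ∀ s ≤ T, Measurable[ℱ s] (ξ s))
    (h : ∀ᵐ ω ∂μ, IsFeasiblePath T (K · ω) (R · ω) 0 (ξ · ω) 0 0) {s : ℕ} (hs : s ≤ T) :
    ∀ᵐ ω ∂μ, -ξ s ω ∉ interior (K s ω) := by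
  suffices hn : ∀ n : ℕ, ∀ᵐ ω ∂μ, -ξ s ω - (1 / ((n : ℝ) + 1)) • unitAsset d N ∉ K s ω by
    filter_upwards [ae_all_iff.2 hn] with ω hω hmem
    obtain ⟨n, hn⟩ := exists_sub_unitAsset_mem hmem
    exact hω n hn
  intro n
  set e : Portfolio d N := (1 / ((n : ℝ) + 1)) • unitAsset d N with he
  have he0 : 0 ≤ e := smul_nonneg (by positivity) (unitAsset_nonneg d N)
  have hene : e ≠ 0 := smul_ne_zero (by positivity) (unitAsset_ne_zero hd)
  have he2 : e.2 = 0 := by simp [he, unitAsset]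
  obtain ⟨A, hA, hAmem⟩ := hK.exists_measurableSet_mem hs (y := fun ω => -ξ s ω - e)
    ((hξ s hs).neg.sub measurable_const)
  have hgain : Measurable[ℱ s] (A.indicator fun _ => e) := measurable_const.indicator hA
  -- On `A` the amount `e` is also withdrawn at date `s`, which is solvent by the choice of `A`.
  -- Since `e` is financial, holdings and returns do not change, and the final wealth is `e` on `A`.
  set ζ : ℕ → Ω → Portfolio d N := fun u ω => ξ u ω + if u = s then A.indicator (fun _ => e) ω else 0
    with hζ
  have hζ2 : ∀ u ω, (ζ u ω).2 = (ξ u ω).2 := by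
    intro u ω
    simp only [hζ]
    split_ifs
    · by_cases hω : ω ∈ A <;> simp [hω, he2]
    · simp
  have hinv : ∀ u ω, invested ζ u ω = holdings (ξ · ω) 0 u := fun u ω => by
    simp only [invested, holdings, hζ2, add_zero]
  have hatt : A.indicator (fun _ => e) ∈ attainable μ ℱ T K R 0 := by
    refine ⟨hgain.mono (ℱ.mono hs) le_rfl, ζ, fun u hu => ⟨?_, ?_, ?_⟩, ?_⟩
    · simp only [hζ]
      split_ifs with hus
      · subst hus
        exact (hξ u hu).add hgain
      · exact (hξ u hu).add measurable_const
    · filter_upwards [h, hAmem] with ω h1 h2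
      have h3 := h1.neg_mem u (Nat.zero_le u) hu
      by_cases hus : u = s
      · subst hus
        by_cases hω : ω ∈ A
        · simpa [hζ, hω, sub_eq_add_neg, add_comm] using h2.1 hω
        · simpa [hζ, hω] using h3
      · simpa [hζ, hus] using h3
    · filter_upwards [h] with ω h1
      rw [hinv, Prod.snd_zero, add_zero]
      rcases hu.eq_or_lt with rfl | hu'
      · have := h1.snd_wealth fun v hv y hy => hR.financial v hv ω y hy
        exact (this.trans (by simp)).ge
      · exact h1.nonneg u (Nat.zero_le u) hu'
    · filter_upwards [h] with ω h1
      have h2 := h1.wealth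
      have h3 : ∑ u ∈ Finset.range (T + 1), ζ u ω
          = ∑ u ∈ Finset.range (T + 1), ξ u ω + A.indicator (fun _ => e) ω := by
        simp only [hζ, Finset.sum_add_distrib, Finset.sum_ite_eq', Finset.mem_range,
          Nat.lt_succ_iff, hs, if_true]
      have h4 : Finset.Icc 0 T = Finset.range (T + 1) := by
        ext u
        simp
      have h5 : Finset.Ico 0 T = Finset.range T := by
        ext u
        simp
      rw [h4, h5] at h2
      simp only [hinv, Prod.snd_zero, zero_add]
      rw [h3, add_right_comm, h2, zero_add]
  have hzero := (hNA _ hatt.1).1 ⟨hatt, ae_of_all _ fun ω => indicator_nonneg (fun _ _ => he0) ω⟩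
  filter_upwards [hzero, hAmem] with ω h1 h2 h3
  rw [indicator_of_mem (h2.2 h3)] at h1
  exact hene h1

/-- Under the dominance conditions on `F'` and `κ`, a path replicating zero trades reversibly in the
financial assets only. -/
theorem IsFeasiblePath.mem_lineality {F F' : ℕ → Set (Portfolio d N)}
    {r : ℕ → (Fin N → ℝ) → Portfolio d N} {x : ℕ → Portfolio d N} (hd : 1 ≤ d)
    (h : IsFeasiblePath T F r 0 x 0 0) (hr : ∀ s ≤ T, ∀ y, 0 ≤ y → (r s y).2 = 0)
    (hF : ∀ s ≤ T, IsSolvencyCone (F s)) (hF' : ∀ s ≤ T, IsSolvencyCone (F' s))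
    (hdom : ∀ s ≤ T, financial (F s) \ lineality (financial (F s)) ⊆ intrinsicInterior ℝ (F' s) ∧
      F s ⊆ F' s)
    {κ : ℕ → Portfolio d N} (hκ : ∀ s ≤ T, κ s ∈ F s)
    (hκri : ∀ s < T, holdings x 0 s ≠ 0 → κ (s + 1) ∈ intrinsicInterior ℝ (financial (F (s + 1))))
    (hint : ∀ s ≤ T, -x s + κ s ∉ interior (F' s)) :
    ∀ s ≤ T, x s ∈ lineality (financial (F s)) := by
  have hneg : ∀ s ≤ T, -x s ∈ F s := fun s hs => h.neg_mem s (Nat.zero_le s) hs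
  have hold : ∀ s ≤ T, holdings x 0 s = 0 := by
    intro s hs
    rcases hs.eq_or_lt with rfl | hs
    · simpa using h.snd_wealth hr
    -- A nonzero holding puts `κ (s + 1)` in the relative interior of the financial cone. If it is
    -- reversible, both cones are the whole space; if not, it is interior to `F' (s + 1)`. Either
    -- way `hint` is violated at `s + 1`.
    by_contra hne
    have hri := hκri s hs hne
    have hs1 : s + 1 ≤ T := hs
    by_cases hk : -κ (s + 1) ∈ F (s + 1)
    · have huniv := (hF _ hs1).mem_intrinsicInterior_financial hd hri hk
      have : F' (s + 1) = univ := univ_subset_iff.1 (huniv ▸ (hdom _ hs1).2)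
      exact hint _ hs1 (by simp [this])
    · have hmem := (hdom _ hs1).1 ⟨intrinsicInterior_subset hri, fun hl => hk hl.2.1⟩
      rw [(hF' _ hs1).intrinsicInterior_eq hd] at hmem
      refine hint _ hs1 ?_
      rw [add_comm (-x (s + 1))]
      exact (hF' _ hs1).add_mem_interior hmem ((hdom _ hs1).2 (hneg _ hs1))
  have hx2 : ∀ s ≤ T, (x s).2 = 0 := by
    intro s hs
    rcases s with _ | s
    · simpa [holdings] using hold 0 hs
    · have h1 := holdings_succ (x := x) (a := 0) s
      rw [hold _ hs, hold s (Nat.le_of_succ_le hs), zero_add] at h1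
      exact h1.symm
  intro s hs
  have hfin : -x s ∈ financial (F s) := ⟨hneg s hs, by simp [hx2 s hs]⟩
  by_cases hl : -x s ∈ lineality (financial (F s))
  · exact ⟨by simpa using hl.2, hl.1⟩
  · have hmem := (hdom s hs).1 ⟨hfin, hl⟩
    rw [(hF' s hs).intrinsicInterior_eq hd] at hmem
    exact absurd ((hF' s hs).add_mem_interior hmem ((hdom s hs).2 (hκ s hs))) (hint s hs)

/-- Under robust no-arbitrage, strategies replicating zero trade reversibly in the financial assets
only. -/
theorem RobustNoArbitrage.ae_mem_lineality (hNA : RobustNoArbitrage μ ℱ T K R) (hd : 1 ≤ d)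
    (hK : IsSolvencyProcess μ ℱ T K) (hR : IsReturnProcess ℱ T R) (hR1 : CondR1 μ T R)
    {t : ℕ} {ξ : ℕ → Ω → Portfolio d N} (hξ : ∀ s ≤ T, Measurable[ℱ s] (ξ s))
    (h : ∀ᵐ ω ∂μ, IsFeasiblePath T (K · ω) (R · ω) t (ξ · ω) 0 0) :
    ∀ᵐ ω ∂μ, ∀ s ≤ T, ξ s ω ∈ lineality (financial (K s ω)) := by
  obtain ⟨K', R', hK', hR', hR'm, hdom, hNA'⟩ := hNA
  have hR1' : ∀ᵐ ω ∂μ, ∀ s ≤ T, R s ω 0 = 0 := by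
    rw [ae_all_iff]
    intro s
    by_cases hs : s ≤ T
    · filter_upwards [hR1 s hs] with ω hω _ using hω.1
    · exact ae_of_all _ fun ω hs' => absurd hs' hs
  have hcones : ∀ᵐ ω ∂μ, ∀ s ≤ T,
      financial (K s ω) \ lineality (financial (K s ω)) ⊆ intrinsicInterior ℝ (K' s ω) ∧
      K s ω ⊆ K' s ω := by
    rw [ae_all_iff]
    intro s
    by_cases hs : s ≤ T
    · filter_upwards [hdom.cones s hs] with ω hω _ using hω
    · exact ae_of_all _ fun ω hs' => absurd hs' hs
  have hreturns : ∀ᵐ ω ∂μ, ∀ s ≤ T, R' s ω 0 ∈ financial (K s ω) ∧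
      ∀ x : Fin N → ℝ, 0 ≤ x → x ≠ 0 →
        R' s ω x - R s ω x ∈ intrinsicInterior ℝ (financial (K s ω)) := by
    rw [ae_all_iff]
    intro s
    by_cases hs : s ≤ T
    · filter_upwards [hdom.returns s hs] with ω hω _ using hω
    · exact ae_of_all _ fun ω hs' => absurd hs' hs
  have h0 : ∀ᵐ ω ∂μ, IsFeasiblePath T (K · ω) (R · ω) 0 (ξ · ω) 0 0 := by
    filter_upwards [h, hK.ae_isSolvencyCone, hR1'] with ω h1 h2 h3
    exact h1.start_zero h2 h3
  -- `κ` is what `R'` pays beyond `R` along `ξ`. Giving it up turns `ξ` into a strategy replicating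
  -- zero in the dominating model, where no-arbitrage applies.
  obtain ⟨κ, hκm, hκ0, hκ⟩ := exists_adapted_sub_smul (t := 0) (hR.isRandomMap hR1) hR'm hξ
    (α := fun _ => 0) (c := fun _ => 1) measurable_const measurable_const
    (fun _ => zero_le_one) (by
      filter_upwards [h0] with ω hω
      exact hω.nonneg)
  have hκmem : ∀ᵐ ω ∂μ, (∀ s ≤ T, κ s ω ∈ financial (K s ω)) ∧
      ∀ s < T, holdings (ξ · ω) 0 s ≠ 0 →
        κ (s + 1) ω ∈ intrinsicInterior ℝ (financial (K (s + 1) ω)) := by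
    filter_upwards [h0, hκ, hreturns, hR1', hK.ae_isSolvencyCone] with ω h1 h2 h3 h4 h5
    have key : ∀ s < T, holdings (ξ · ω) 0 s ≠ 0 →
        κ (s + 1) ω ∈ intrinsicInterior ℝ (financial (K (s + 1) ω)) := by
      intro s hs hne
      have := (h3 (s + 1) hs).2 _ (h1.nonneg s (Nat.zero_le s) hs) hne
      rwa [h2 s (Nat.zero_le s) hs, one_smul, one_smul]
    refine ⟨fun s hs => ?_, key⟩
    rcases s with _ | s
    · rw [hκ0 0 le_rfl ω]
      exact ⟨(h5 0 hs).zero_mem, rfl⟩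
    · by_cases hne : holdings (ξ · ω) 0 s = 0
      · rw [h2 s (Nat.zero_le s) hs, hne, smul_zero, h4 _ hs, smul_zero, sub_zero]
        exact (h3 _ hs).1
      · exact intrinsicInterior_subset (key s hs hne)
  have h' : ∀ᵐ ω ∂μ, IsFeasiblePath T (K' · ω) (R' · ω) 0 (fun s => ξ s ω - κ s ω) 0 0 := by
    filter_upwards [h0, hκ, hκmem, hcones, hK'.ae_isSolvencyCone] with ω h1 h2 h3 h4 h5
    have := h1.smul_sub (F' := (K' · ω)) (r' := (R' · ω)) (Nat.zero_le T) zero_le_one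
      (κ := (κ · ω)) (fun s hs => hκ0 s hs ω) h2 (fun s hs => (h3.1 s hs).2) (fun s hs hsT => by
        have := (h5 s hsT).add_mem ((h4 s hsT).2 (h1.neg_mem s hs hsT))
          ((h4 s hsT).2 (h3.1 s hsT).1)
        convert! this using 1
        simp only [one_smul]
        abel)
    simpa using this
  have hint : ∀ᵐ ω ∂μ, ∀ s ≤ T, -ξ s ω + κ s ω ∉ interior (K' s ω) := by
    rw [ae_all_iff]
    intro s
    by_cases hs : s ≤ T
    · filter_upwards [hNA'.ae_neg_notMem_interior hK' hR' hd
        (ξ := fun s ω => ξ s ω - κ s ω) (fun s hs => (hξ s hs).sub (hκm s hs)) h' hs] with ω hω _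
      rwa [neg_sub, sub_eq_neg_add] at hω
    · exact ae_of_all _ fun ω hs' => absurd hs' hs
  filter_upwards [h0, hκmem, hcones, hK.ae_isSolvencyCone, hK'.ae_isSolvencyCone, hint]
    with ω h1 h2 h3 h4 h5 h6
  exact h1.mem_lineality hd (fun s hs y hy => hR.financial s hs ω y hy) h4 h5 h3
    (fun s hs => (h2.1 s hs).1) h2.2 h6

end Arbitrage

/-! ### Operations on strategies and limits of bounded first transfers. -/

section Closedness

variable {Ω : Type*} {m : MeasurableSpace Ω} {d N : ℕ}

/-- The properties of a market model that make the set of reachable wealths closed. -/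
structure IsRegularModel (μ : Measure Ω) (ℱ : Filtration ℕ m) (T : ℕ)
    (K : ℕ → Ω → Set (Portfolio d N)) (R : ℕ → Ω → (Fin N → ℝ) → Portfolio d N) : Prop where
  cone : ∀ᵐ ω ∂μ, ∀ s ≤ T, IsSolvencyCone (K s ω)
  map_zero : ∀ᵐ ω ∂μ, ∀ s ≤ T, R s ω 0 = 0
  continuousOn : ∀ᵐ ω ∂μ, ∀ s ≤ T, ContinuousOn (R s ω) {x | 0 ≤ x}
  financial : ∀ s ≤ T, ∀ ω, ∀ x : Fin N → ℝ, 0 ≤ x → (R s ω x).2 = 0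
  isRandomMap : IsRandomMap μ ℱ T R
  sub_smul_mem : ∀ᵐ ω ∂μ, ∀ s ≤ T, ∀ c : ℝ, 0 ≤ c → c ≤ 1 → ∀ x : Fin N → ℝ, 0 ≤ x →
    R s ω (c • x) - c • R s ω x ∈ K s ω
  mem_lineality : ∀ (t : ℕ) (ξ : ℕ → Ω → Portfolio d N), (∀ s ≤ T, Measurable[ℱ s] (ξ s)) →
    (∀ᵐ ω ∂μ, IsFeasiblePath T (K · ω) (R · ω) t (ξ · ω) 0 0) →
    ∀ᵐ ω ∂μ, ∀ s ≤ T, ξ s ω ∈ lineality (_root_.financial (K s ω))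

/-- The adapted process `ξ` trades from date `t` on, from the industrial holding `α` to the wealth
`g`. -/
structure IsStrategyFor (μ : Measure Ω) (ℱ : Filtration ℕ m) (T : ℕ)
    (K : ℕ → Ω → Set (Portfolio d N)) (R : ℕ → Ω → (Fin N → ℝ) → Portfolio d N) (t : ℕ)
    (α : Ω → Fin N → ℝ) (g : Ω → Portfolio d N) (ξ : ℕ → Ω → Portfolio d N) : Prop where
  measurable : ∀ s ≤ T, Measurable[ℱ s] (ξ s)
  zero_of_lt : ∀ s < t, ∀ ω, ξ s ω = 0
  feasible : ∀ᵐ ω ∂μ, IsFeasiblePath T (K · ω) (R · ω) t (ξ · ω) (α ω) (g ω)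

/-- The wealth `g` can be reached from the industrial holding `α` at date `t`. -/
def Reachable (μ : Measure Ω) (ℱ : Filtration ℕ m) (T : ℕ)
    (K : ℕ → Ω → Set (Portfolio d N)) (R : ℕ → Ω → (Fin N → ℝ) → Portfolio d N) (t : ℕ)
    (α : Ω → Fin N → ℝ) (g : Ω → Portfolio d N) : Prop :=
  ∃ ξ, IsStrategyFor μ ℱ T K R t α g ξ

/-- The set of reachable pairs is closed under almost sure convergence. -/
def ReachableClosed (μ : Measure Ω) (ℱ : Filtration ℕ m) (T : ℕ)
    (K : ℕ → Ω → Set (Portfolio d N)) (R : ℕ → Ω → (Fin N → ℝ) → Portfolio d N) (t : ℕ) : Prop :=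
  ∀ (α : ℕ → Ω → Fin N → ℝ) (g : ℕ → Ω → Portfolio d N) (α' : Ω → Fin N → ℝ)
    (g' : Ω → Portfolio d N), (∀ n, Measurable[ℱ t] (α n)) →
    (∀ n, Reachable μ ℱ T K R t (α n) (g n)) →
    (∀ᵐ ω ∂μ, Tendsto (fun n => α n ω) atTop (𝓝 (α' ω))) →
    (∀ᵐ ω ∂μ, Tendsto (fun n => g n ω) atTop (𝓝 (g' ω))) → Reachable μ ℱ T K R t α' g'

variable {μ : Measure Ω} {ℱ : Filtration ℕ m} {T t : ℕ}
  {K : ℕ → Ω → Set (Portfolio d N)} {R : ℕ → Ω → (Fin N → ℝ) → Portfolio d N}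

/-- An index known at `t` is known at all later dates. Before `t` the transfers vanish at every `ω`,
not just almost surely, so the switched process is adapted there too. -/
theorem IsStrategyFor.comp_index {α : ℕ → Ω → Fin N → ℝ} {g : ℕ → Ω → Portfolio d N}
    {ξ : ℕ → ℕ → Ω → Portfolio d N} (h : ∀ n, IsStrategyFor μ ℱ T K R t (α n) (g n) (ξ n))
    {τ : Ω → ℕ} (hτ : Measurable[ℱ t] τ) :
    IsStrategyFor μ ℱ T K R t (fun ω => α (τ ω) ω) (fun ω => g (τ ω) ω)
      (fun s ω => ξ (τ ω) s ω) where
  measurable s hs := by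
    rcases lt_or_ge s t with hst | hst
    · have : (fun ω => ξ (τ ω) s ω) = fun _ => 0 := funext fun ω => (h _).zero_of_lt s hst ω
      rw [this]
      exact measurable_const
    · exact measurable_apply_index (fun n => (h n).measurable s hs)
        (hτ.mono (ℱ.mono hst) le_rfl)
  zero_of_lt s hs ω := (h _).zero_of_lt s hs ω
  feasible := by
    filter_upwards [ae_all_iff.2 fun n => (h n).feasible] with ω hω
    exact hω (τ ω)

theorem IsStrategyFor.indicator (hM : IsRegularModel μ ℱ T K R) {α : Ω → Fin N → ℝ}
    {g : Ω → Portfolio d N} {ξ : ℕ → Ω → Portfolio d N} (h : IsStrategyFor μ ℱ T K R t α g ξ)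
    {B : Set Ω} (hB : MeasurableSet[ℱ t] B) :
    IsStrategyFor μ ℱ T K R t (B.indicator α) (B.indicator g) (fun s => B.indicator (ξ s)) where
  measurable s hs := by
    rcases lt_or_ge s t with hst | hst
    · have : B.indicator (ξ s) = fun _ => 0 := funext fun ω => by
        by_cases hω : ω ∈ B <;> simp [hω, h.zero_of_lt s hst]
      rw [this]
      exact measurable_const
    · exact (h.measurable s hs).indicator (ℱ.mono hst _ hB)
  zero_of_lt s hs ω := by by_cases hω : ω ∈ B <;> simp [hω, h.zero_of_lt s hs]
  feasible := by
    filter_upwards [h.feasible, hM.cone, hM.map_zero] with ω h1 h2 h3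
    by_cases hω : ω ∈ B
    · simpa [hω] using h1
    · simp only [indicator_of_notMem hω]
      exact isFeasiblePath_zero h2 h3

theorem Reachable.of_indicator {α : Ω → Fin N → ℝ} {g : Ω → Portfolio d N} {B : Set Ω}
    (hB : MeasurableSet[ℱ t] B) (h : Reachable μ ℱ T K R t (B.indicator α) (B.indicator g))
    (h' : Reachable μ ℱ T K R t (Bᶜ.indicator α) (Bᶜ.indicator g)) :
    Reachable μ ℱ T K R t α g := by
  obtain ⟨ξ, hξ⟩ := h
  obtain ⟨ζ, hζ⟩ := h'
  refine ⟨fun s => B.indicator (ξ s) + Bᶜ.indicator (ζ s), fun s hs => ?_, fun s hs ω => ?_, ?_⟩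
  · rcases lt_or_ge s t with hst | hst
    · have : B.indicator (ξ s) + Bᶜ.indicator (ζ s) = fun _ => 0 := funext fun ω => by
        by_cases hω : ω ∈ B <;> simp [hω, hξ.zero_of_lt s hst, hζ.zero_of_lt s hst]
      rw [this]
      exact measurable_const
    · have hB' := ℱ.mono hst _ hB
      exact ((hξ.measurable s hs).indicator hB').add ((hζ.measurable s hs).indicator hB'.compl)
  · by_cases hω : ω ∈ B <;> simp [hω, hξ.zero_of_lt s hs, hζ.zero_of_lt s hs]
  · filter_upwards [hξ.feasible, hζ.feasible] with ω h1 h2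
    by_cases hω : ω ∈ B
    · simpa [hω] using h1
    · simpa [hω] using h2

theorem Reachable.congr_ae {α α' : Ω → Fin N → ℝ} {g g' : Ω → Portfolio d N}
    (h : Reachable μ ℱ T K R t α g) (hα : ∀ᵐ ω ∂μ, α ω = α' ω) (hg : ∀ᵐ ω ∂μ, g ω = g' ω) :
    Reachable μ ℱ T K R t α' g' := by
  obtain ⟨ξ, hξ⟩ := h
  refine ⟨ξ, hξ.measurable, hξ.zero_of_lt, ?_⟩
  filter_upwards [hξ.feasible, hα, hg] with ω h1 h2 h3
  rwa [h2, h3] at h1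

/-- By concavity, strategies may be scaled down at random. -/
theorem IsStrategyFor.exists_smul (hM : IsRegularModel μ ℱ T K R) (ht : t ≤ T)
    {α : Ω → Fin N → ℝ} {g : Ω → Portfolio d N} {ξ : ℕ → Ω → Portfolio d N}
    (h : IsStrategyFor μ ℱ T K R t α g ξ) (hα : Measurable[ℱ t] α) {c : Ω → ℝ}
    (hc : Measurable[ℱ t] c) (hc0 : ∀ ω, 0 ≤ c ω) (hc1 : ∀ ω, c ω ≤ 1) :
    ∃ ζ, IsStrategyFor μ ℱ T K R t (fun ω => c ω • α ω) (fun ω => c ω • g ω) ζ ∧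
      ∀ ω, ζ t ω = c ω • ξ t ω := by
  obtain ⟨κ, hκm, hκ0, hκ⟩ := exists_adapted_sub_smul hM.isRandomMap hM.isRandomMap h.measurable
    hα hc hc0 (h.feasible.mono fun ω hω => hω.nonneg)
  refine ⟨fun s ω => c ω • ξ s ω - κ s ω, ⟨fun s hs => ?_, fun s hs ω => ?_, ?_⟩, fun ω => ?_⟩
  · rcases lt_or_ge s t with hst | hst
    · have : (fun ω => c ω • ξ s ω - κ s ω) = fun _ => 0 := funext fun ω => by
        rw [h.zero_of_lt s hst, hκ0 s hst.le, smul_zero, sub_zero]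
      rw [this]
      exact measurable_const
    · exact ((hc.mono (ℱ.mono hst) le_rfl).smul (h.measurable s hs)).sub (hκm s hs)
  · rw [h.zero_of_lt s hs, hκ0 s hs.le, smul_zero, sub_zero]
  · filter_upwards [h.feasible, hκ, hM.cone, hM.sub_smul_mem] with ω h1 h2 h3 h4
    have hκK : ∀ s ≤ T, κ s ω ∈ K s ω ∧ (κ s ω).2 = 0 := by
      intro s hs
      rcases le_or_gt s t with hst | hst
      · rw [hκ0 s hst]
        exact ⟨(h3 s hs).zero_mem, rfl⟩
      · obtain ⟨u, rfl⟩ : ∃ u, s = u + 1 := ⟨s - 1, by lia⟩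
        have hu0 := h1.nonneg u (by lia) hs
        rw [h2 u (by lia) hs]
        refine ⟨h4 _ hs _ (hc0 ω) (hc1 ω) _ hu0, ?_⟩
        rw [Prod.snd_sub, Prod.smul_snd, hM.financial _ hs ω _ (smul_nonneg (hc0 ω) hu0),
          hM.financial _ hs ω _ hu0, smul_zero, sub_zero]
    refine h1.smul_sub ht (hc0 ω) (fun s hs => hκ0 s hs ω) h2 (fun s hs => (hκK s hs).2)
      fun s hs hsT => ?_
    have := (h3 s hsT).add_mem ((h3 s hsT).smul_mem (hc0 ω) (h1.neg_mem s hs hsT)) (hκK s hsT).1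
    convert! this using 1
    simp only [smul_neg]
    abel
  · simp only [hκ0 t le_rfl, sub_zero]

theorem reachableClosed_terminal (hM : IsRegularModel μ ℱ T K R) :
    ReachableClosed μ ℱ T K R T := by
  intro α g α' g' _ h _ hg
  choose ξ hξ using h
  obtain ⟨f, hf, hlim⟩ := exists_measurable_limit fun n => (hξ n).measurable T le_rfl
  refine ⟨fun s => if s = T then f else 0, fun s hs => ?_, fun s hs ω => ?_, ?_⟩
  · split_ifs with h
    · exact h ▸ hf
    · exact measurable_const
  · simp [hs.ne]
  · filter_upwards [hg, hM.cone, ae_all_iff.2 fun n => (hξ n).feasible] with ω h1 h2 h3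
    have hg' : ∀ n, ξ n T ω = g n ω := fun n => by simpa using (h3 n).wealth
    have hfg : f ω = g' ω := hlim ω _ (by simpa only [hg'] using h1)
    have hmem : -g' ω ∈ K T ω := (h2 T le_rfl).isClosed.mem_of_tendsto h1.neg
      (Eventually.of_forall fun n => hg' n ▸ (h3 n).neg_mem T le_rfl le_rfl)
    refine ⟨fun s hs => by simp [hs.ne], fun s hs hsT => ?_, fun s hs hsT => by lia, ?_⟩
    · obtain rfl := le_antisymm hsT hs
      simpa [hfg] using hmem
    · simp [hfg]

/-- Once the first transfers converge, so do the holdings and the remaining wealths at `t + 1`. The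
continuation comes from the hypothesis at `t + 1` and need not be a limit of the `ξ n`. -/
theorem ReachableClosed.exists_limit_of_tendsto (hM : IsRegularModel μ ℱ T K R) (ht : t < T)
    (hcl : ReachableClosed μ ℱ T K R (t + 1)) {α : ℕ → Ω → Fin N → ℝ}
    {g : ℕ → Ω → Portfolio d N} {α' : Ω → Fin N → ℝ} {g' : Ω → Portfolio d N}
    {ξ : ℕ → ℕ → Ω → Portfolio d N} (hαm : ∀ n, Measurable[ℱ t] (α n))
    (h : ∀ n, IsStrategyFor μ ℱ T K R t (α n) (g n) (ξ n))
    (hα : ∀ᵐ ω ∂μ, Tendsto (fun n => α n ω) atTop (𝓝 (α' ω)))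
    (hg : ∀ᵐ ω ∂μ, Tendsto (fun n => g n ω) atTop (𝓝 (g' ω)))
    {η : Ω → Portfolio d N} (hη : Measurable[ℱ t] η)
    (hlim : ∀ᵐ ω ∂μ, Tendsto (fun n => ξ n t ω) atTop (𝓝 (η ω))) :
    ∃ ζ, IsStrategyFor μ ℱ T K R t α' g' ζ ∧ ∀ ω, ζ t ω = η ω := by
  have hpath : ∀ᵐ ω ∂μ, ∀ n, -ξ n t ω ∈ K t ω ∧ 0 ≤ (ξ n t ω).2 + α n ω ∧
      IsFeasiblePath T (K · ω) (R · ω) (t + 1) (Function.update (ξ n · ω) t 0)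
        ((ξ n t ω).2 + α n ω) (g n ω - ξ n t ω - R (t + 1) ω ((ξ n t ω).2 + α n ω)) := by
    filter_upwards [ae_all_iff.2 fun n => (h n).feasible] with ω hω n
    have hz : ∀ s ≤ t, Function.update (ξ n · ω) t 0 s = 0 := by
      intro s hs
      rcases hs.eq_or_lt with rfl | hs
      · simp
      · simpa [hs.ne] using (h n).zero_of_lt s hs ω
    refine (isFeasiblePath_update_iff (F := (K · ω)) (r := (R · ω)) ht hz).1 ?_
    simpa using hω n
  have hlim2 : ∀ᵐ ω ∂μ, Tendsto (fun n => (ξ n t ω).2 + α n ω) atTop (𝓝 ((η ω).2 + α' ω)) ∧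
      0 ≤ (η ω).2 + α' ω := by
    filter_upwards [hα, hlim, hpath] with ω h1 h2 h3
    have := ((continuous_snd.tendsto _).comp h2).add h1
    exact ⟨this, ge_of_tendsto' this fun n => (h3 n).2.1⟩
  obtain ⟨ζ, hζ⟩ := hcl (fun n ω => (ξ n t ω).2 + α n ω)
    (fun n ω => g n ω - ξ n t ω - R (t + 1) ω ((ξ n t ω).2 + α n ω))
    (fun ω => (η ω).2 + α' ω) (fun ω => g' ω - η ω - R (t + 1) ω ((η ω).2 + α' ω))
    (fun n => ((measurable_snd.comp ((h n).measurable t ht.le)).add (hαm n)).mono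
      (ℱ.mono (Nat.le_succ t)) le_rfl)
    (fun n => ⟨fun s => if s = t then 0 else ξ n s, fun s hs => by
        split_ifs
        · exact measurable_const
        · exact (h n).measurable s hs, fun s hs ω => by
        by_cases hst : s = t
        · simp [hst]
        · simpa [hst] using (h n).zero_of_lt s (by lia) ω, by
        filter_upwards [hpath] with ω hω
        convert! (hω n).2.2 using 1
        funext s
        by_cases hst : s = t <;> simp [hst]⟩)
    (hlim2.mono fun ω hω => hω.1) (by
      filter_upwards [hg, hlim, hlim2, hpath, hM.continuousOn] with ω h1 h2 h3 h4 h5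
      refine (h1.sub h2).sub ?_
      exact ((h5 (t + 1) ht) _ h3.2).tendsto.comp
        (tendsto_nhdsWithin_iff.2 ⟨h3.1, Eventually.of_forall fun n => (h4 n).2.1⟩))
  refine ⟨fun s => if s = t then η else ζ s, ⟨fun s hs => ?_, fun s hs ω => ?_, ?_⟩, fun ω => ?_⟩
  · split_ifs with hst
    · exact hst ▸ hη
    · exact hζ.measurable s hs
  · simpa [hs.ne] using hζ.zero_of_lt s (by lia) ω
  · filter_upwards [hζ.feasible, hlim, hlim2, hpath, hM.cone] with ω h1 h2 h3 h4 h5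
    have heq : (fun s => (if s = t then η else ζ s) ω) = Function.update (ζ · ω) t (η ω) := by
      funext s
      by_cases hst : s = t
      · subst hst
        simp
      · simp [hst]
    rw [heq, isFeasiblePath_update_iff ht fun s hs => hζ.zero_of_lt s (by lia) ω]
    exact ⟨(h5 t ht.le).isClosed.mem_of_tendsto h2.neg (Eventually.of_forall fun n => (h4 n).1),
      h3.2, h1⟩
  · simp

/-- The random subsequence is kept in the conclusion because properties of the first transfer, such
as its norm and its vanishing coordinates, are later read off along it. -/
theorem ReachableClosed.exists_limit (hM : IsRegularModel μ ℱ T K R) (ht : t < T)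
    (hcl : ReachableClosed μ ℱ T K R (t + 1)) {α : ℕ → Ω → Fin N → ℝ}
    {g : ℕ → Ω → Portfolio d N} {α' : Ω → Fin N → ℝ} {g' : Ω → Portfolio d N}
    {ξ : ℕ → ℕ → Ω → Portfolio d N} (hαm : ∀ n, Measurable[ℱ t] (α n))
    (h : ∀ n, IsStrategyFor μ ℱ T K R t (α n) (g n) (ξ n))
    (hα : ∀ᵐ ω ∂μ, Tendsto (fun n => α n ω) atTop (𝓝 (α' ω)))
    (hg : ∀ᵐ ω ∂μ, Tendsto (fun n => g n ω) atTop (𝓝 (g' ω)))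
    (hb : ∀ ω, ∃ M : ℕ, ∃ᶠ n in atTop, ‖ξ n t ω‖ ≤ M) :
    ∃ ζ, IsStrategyFor μ ℱ T K R t α' g' ζ ∧ ∃ τ : ℕ → Ω → ℕ, (∀ k ω, k ≤ τ k ω) ∧
      ∀ ω, Tendsto (fun k => ξ (τ k ω) t ω) atTop (𝓝 (ζ t ω)) := by
  obtain ⟨τ, hτm, hτ, η, hη, hlim⟩ :=
    exists_random_subsequence (fun n => (h n).measurable t ht.le) hb
  have htend : ∀ ω, Tendsto (τ · ω) atTop atTop := fun ω => tendsto_atTop_mono (hτ · ω) tendsto_id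
  obtain ⟨ζ, hζ, hζη⟩ := hcl.exists_limit_of_tendsto hM ht (α := fun k ω => α (τ k ω) ω)
    (g := fun k ω => g (τ k ω) ω) (ξ := fun k s ω => ξ (τ k ω) s ω)
    (fun k => measurable_apply_index hαm (hτm k)) (fun k => IsStrategyFor.comp_index h (hτm k))
    (hα.mono fun ω hω => hω.comp (htend ω)) (hg.mono fun ω hω => hω.comp (htend ω)) hη
    (ae_of_all _ hlim)
  exact ⟨ζ, hζ, τ, hτ, fun ω => hζη ω ▸ hlim ω⟩

end Closedness

/-! ### Gaussian elimination with a measurable pivot. -/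

section Elimination

variable {d : ℕ}

/-- The ratio of `y` to `z` at the first nonzero coordinate of `z`. -/
noncomputable def leadingRatio (y z : Fin d → ℝ) : ℝ :=
  -- The product removes the terms after the first nonzero coordinate of `z`; those before it vanish
  -- because division by 0 gives 0.
  ∑ i, y i / z i * ∏ j ∈ Finset.Iio i, if z j = 0 then 1 else 0

theorem measurable_leadingRatio :
    Measurable fun p : (Fin d → ℝ) × (Fin d → ℝ) => leadingRatio p.1 p.2 := by
  have h1 : ∀ i, Measurable fun p : (Fin d → ℝ) × (Fin d → ℝ) => p.1 i := fun i =>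
    (measurable_pi_apply i).comp measurable_fst
  have h2 : ∀ i, Measurable fun p : (Fin d → ℝ) × (Fin d → ℝ) => p.2 i := fun i =>
    (measurable_pi_apply i).comp measurable_snd
  exact Finset.measurable_fun_sum _ fun i _ => ((h1 i).div (h2 i)).mul <|
    Finset.measurable_fun_prod _ fun j _ =>
      Measurable.ite (h2 j (measurableSet_singleton 0)) measurable_const measurable_const

theorem exists_leadingRatio_eq {z : Fin d → ℝ} (hz : z ≠ 0) :
    ∃ j, z j ≠ 0 ∧ ∀ y, leadingRatio y z = y j / z j := by
  obtain ⟨i, hi⟩ := Function.ne_iff.1 hz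
  obtain ⟨j, hj, hmin⟩ := (Finset.univ.filter fun i => z i ≠ 0).exists_min_image id
    ⟨i, by simpa using hi⟩
  simp only [Finset.mem_filter, Finset.mem_univ, true_and, id_eq] at hj hmin
  refine ⟨j, hj, fun y => ?_⟩
  rw [leadingRatio, Finset.sum_eq_single j]
  · rw [Finset.prod_eq_one, mul_one]
    intro k hk
    rw [if_pos]
    by_contra hne
    exact absurd (hmin k hne) (not_le.2 (Finset.mem_Iio.1 hk))
  · intro i _ hij
    by_cases hi : z i = 0
    · simp [hi]
    · rw [Finset.prod_eq_zero (i := j), mul_zero]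
      · exact Finset.mem_Iio.2 (lt_of_le_of_ne (hmin i hi) hij.symm)
      · simp [hj]
  · simp

/-- Subtracting the multiples of `z` given by the leading ratios leaves a sequence with fewer
nontrivial coordinates. -/
theorem ncard_sub_leadingRatio_lt {y : ℕ → Fin d → ℝ} {z : Fin d → ℝ} (hz : z ≠ 0)
    (hyz : ∀ i, (∀ n, y n i = 0) → z i = 0) :
    {i | ∃ n, (y n - leadingRatio (y n) z • z) i ≠ 0}.ncard < {i | ∃ n, y n i ≠ 0}.ncard := by
  obtain ⟨j, hj, hratio⟩ := exists_leadingRatio_eq hz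
  refine ncard_lt_ncard (ssubset_iff_exists.2 ⟨?_, j, ?_, ?_⟩) (toFinite _)
  · rintro i ⟨n, hn⟩
    by_contra hne
    have h0 : ∀ n, y n i = 0 := by simpa using hne
    exact hn (by simp [h0 n, hyz i h0])
  · by_contra hne
    exact hj (hyz j (by simpa using hne))
  · rintro ⟨n, hn⟩
    exact hn (by simp [hratio, hj])

end Elimination

/-! ### Diverging first transfers and the backward induction. -/

section Closedness

variable {Ω : Type*} {m : MeasurableSpace Ω} {d N : ℕ} {μ : Measure Ω} {ℱ : Filtration ℕ m}
  {T t : ℕ} {K : ℕ → Ω → Set (Portfolio d N)} {R : ℕ → Ω → (Fin N → ℝ) → Portfolio d N}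
  {α : ℕ → Ω → Fin N → ℝ} {g : ℕ → Ω → Portfolio d N} {α' : Ω → Fin N → ℝ}
  {g' : Ω → Portfolio d N} {ξ : ℕ → ℕ → Ω → Portfolio d N}

/-- The event that the norms of a sequence of random vectors tend to infinity. -/
def divergenceSet (f : ℕ → Ω → Portfolio d N) : Set Ω :=
  {ω | ∀ M : ℕ, ∀ᶠ n in atTop, (M : ℝ) < ‖f n ω‖}

theorem measurableSet_divergenceSet {m' : MeasurableSpace Ω} {f : ℕ → Ω → Portfolio d N}
    (hf : ∀ n, Measurable (f n)) : MeasurableSet (divergenceSet f) := by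
  simp only [divergenceSet, eventually_atTop, ofPred_forall, ofPred_exists]
  refine MeasurableSet.iInter fun M => MeasurableSet.iUnion fun a => MeasurableSet.iInter fun b =>
    MeasurableSet.iInter fun _ => measurableSet_lt measurable_const (hf b).norm

theorem tendsto_indicator {E : Type*} [Zero E] [TopologicalSpace E] {f : ℕ → Ω → E} {f' : Ω → E}
    (B : Set Ω) {ω : Ω} (h : Tendsto (fun n => f n ω) atTop (𝓝 (f' ω))) :
    Tendsto (fun n => B.indicator (f n) ω) atTop (𝓝 (B.indicator f' ω)) := by
  by_cases hω : ω ∈ B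
  · simpa only [indicator_of_mem hω] using h
  · simp only [indicator_of_notMem hω]
    exact tendsto_const_nhds

/-- The strategies are set to zero on the divergence set, so that infinitely many first transfers
are bounded at every `ω`. -/
theorem ReachableClosed.reachable_compl_divergenceSet (hM : IsRegularModel μ ℱ T K R) (ht : t < T)
    (hcl : ReachableClosed μ ℱ T K R (t + 1)) (hαm : ∀ n, Measurable[ℱ t] (α n))
    (h : ∀ n, IsStrategyFor μ ℱ T K R t (α n) (g n) (ξ n))
    (hα : ∀ᵐ ω ∂μ, Tendsto (fun n => α n ω) atTop (𝓝 (α' ω)))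
    (hg : ∀ᵐ ω ∂μ, Tendsto (fun n => g n ω) atTop (𝓝 (g' ω))) :
    Reachable μ ℱ T K R t ((divergenceSet fun n => ξ n t)ᶜ.indicator α')
      ((divergenceSet fun n => ξ n t)ᶜ.indicator g') := by
  have hB := measurableSet_divergenceSet fun n => (h n).measurable t ht.le
  set B := divergenceSet fun n => ξ n t with hBdef
  obtain ⟨ζ, hζ, -⟩ := hcl.exists_limit hM ht (fun n => (hαm n).indicator hB.compl)
    (fun n => (h n).indicator hM hB.compl) (hα.mono fun ω hω => tendsto_indicator Bᶜ hω)
    (hg.mono fun ω hω => tendsto_indicator Bᶜ hω) (by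
      intro ω
      by_cases hω : ω ∈ B
      · exact ⟨0, Frequently.of_forall fun n => by simp [hω]⟩
      · have hω' := hω
        simp only [hBdef, divergenceSet, mem_ofPred_eq, not_forall, not_eventually, not_lt] at hω'
        obtain ⟨M, hM⟩ := hω'
        exact ⟨M, by simpa [hω] using hM⟩)
  exact ⟨ζ, hζ⟩

/-- Where the first transfers diverge, their directions accumulate at a strategy replicating
zero. -/
theorem ReachableClosed.exists_direction (hM : IsRegularModel μ ℱ T K R) (ht : t < T)
    (hcl : ReachableClosed μ ℱ T K R (t + 1)) (hαm : ∀ n, Measurable[ℱ t] (α n))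
    (h : ∀ n, IsStrategyFor μ ℱ T K R t (α n) (g n) (ξ n))
    (hα : ∀ᵐ ω ∂μ, Tendsto (fun n => α n ω) atTop (𝓝 (α' ω)))
    (hg : ∀ᵐ ω ∂μ, Tendsto (fun n => g n ω) atTop (𝓝 (g' ω))) :
    ∃ z, IsStrategyFor μ ℱ T K R t 0 0 z ∧
      (∀ ω ∈ divergenceSet fun n => ξ n t, z t ω ≠ 0) ∧
      ∀ ω i, (∀ n, (ξ n t ω).1 i = 0) → (z t ω).1 i = 0 := by
  have hB := measurableSet_divergenceSet fun n => (h n).measurable t ht.le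
  set B := divergenceSet fun n => ξ n t with hBdef
  -- The maximum keeps the factor at most 1, as scaling by concavity requires. On the divergence set
  -- it is eventually the inverse norm, so the scaled transfers have norm 1 and their limit is
  -- nonzero.
  let c : ℕ → Ω → ℝ := fun n ω => (max 1 ‖ξ n t ω‖)⁻¹
  have hmax : ∀ n ω, 0 < max 1 ‖ξ n t ω‖ := fun n ω => zero_lt_one.trans_le (le_max_left _ _)
  have hc0 : ∀ n ω, 0 ≤ c n ω := fun n ω => (inv_pos.2 (hmax n ω)).le
  have hc1 : ∀ n ω, c n ω ≤ 1 := fun n ω => inv_le_one_of_one_le₀ (le_max_left _ _)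
  have hcm : ∀ n, Measurable[ℱ t] (c n) := fun n =>
    (show Measurable fun x : Portfolio d N => (max 1 ‖x‖)⁻¹ by fun_prop).comp
      ((h n).measurable t ht.le)
  choose ζ hζ hζt using fun n =>
    (h n).exists_smul hM ht.le (hαm n) (hcm n) (hc0 n) (hc1 n)
  have hclim : ∀ ω ∈ B, Tendsto (fun n => c n ω) atTop (𝓝 0) := by
    intro ω hω
    refine tendsto_inv_atTop_zero.comp (tendsto_atTop_mono (fun n => le_max_right 1 _) ?_)
    refine tendsto_atTop.2 fun b => ?_
    obtain ⟨M, hM⟩ := exists_nat_ge b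
    exact (hω M).mono fun n hn => hM.trans hn.le
  have hlim0 : ∀ {E : Type _} [NormedAddCommGroup E] [NormedSpace ℝ E] {f : ℕ → Ω → E} {f' : Ω → E}
      {ω : Ω}, Tendsto (fun n => f n ω) atTop (𝓝 (f' ω)) →
      Tendsto (fun n => B.indicator (fun ω => c n ω • f n ω) ω) atTop (𝓝 0) := by
    intro E _ _ f f' ω hf
    by_cases hω : ω ∈ B
    · simpa [hω] using (hclim ω hω).smul hf
    · simp [hω]
  obtain ⟨z, hz, τ, hτ, hzlim⟩ := hcl.exists_limit hM ht (α' := 0) (g' := 0)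
    (fun n => ((hcm n).smul (hαm n)).indicator hB) (fun n => (hζ n).indicator hM hB)
    (hα.mono fun ω hω => hlim0 hω) (hg.mono fun ω hω => hlim0 hω) (by
      intro ω
      refine ⟨1, Frequently.of_forall fun n => ?_⟩
      by_cases hω : ω ∈ B
      · rw [indicator_of_mem hω, hζt, norm_smul, Real.norm_of_nonneg (hc0 n ω), Nat.cast_one,
          inv_mul_le_one₀ (hmax n ω)]
        exact le_max_right _ _
      · simp [hω])
  refine ⟨z, hz, fun ω hω hz0 => ?_, fun ω i hi => ?_⟩
  · have h1 : Tendsto (fun k => ‖B.indicator (ζ (τ k ω) t) ω‖) atTop (𝓝 ‖z t ω‖) :=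
      (hzlim ω).norm
    have h2 : ∀ᶠ k in atTop, ‖B.indicator (ζ (τ k ω) t) ω‖ = 1 := by
      have htend : Tendsto (τ · ω) atTop atTop := tendsto_atTop_mono (hτ · ω) tendsto_id
      filter_upwards [htend.eventually (hω 1)] with k hk
      rw [Nat.cast_one] at hk
      rw [indicator_of_mem hω, hζt, norm_smul, Real.norm_of_nonneg (hc0 _ ω)]
      simp only [c, max_eq_right hk.le]
      exact inv_mul_cancel₀ (zero_lt_one.trans hk).ne'
    rw [hz0, norm_zero] at h1
    exact zero_ne_one (tendsto_nhds_unique h1 ((tendsto_congr' h2).2 tendsto_const_nhds))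
  · have h1 : Tendsto (fun k => (B.indicator (ζ (τ k ω) t) ω).1 i) atTop (𝓝 ((z t ω).1 i)) :=
      (((continuous_apply i).comp continuous_fst).tendsto _).comp (hzlim ω)
    have h2 : ∀ k, (B.indicator (ζ (τ k ω) t) ω).1 i = 0 := by
      intro k
      by_cases hω : ω ∈ B
      · rw [indicator_of_mem hω, hζt]
        simp [hi]
      · simp [hω]
    simp only [h2] at h1
    exact tendsto_nhds_unique h1 tendsto_const_nhds

/-- Where the first transfers diverge, a reversible strategy can be subtracted so as to remove one
financial asset from them. -/
theorem ReachableClosed.exists_reduction (hM : IsRegularModel μ ℱ T K R) (ht : t < T)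
    (hcl : ReachableClosed μ ℱ T K R (t + 1)) (hαm : ∀ n, Measurable[ℱ t] (α n))
    (h : ∀ n, IsStrategyFor μ ℱ T K R t (α n) (g n) (ξ n))
    (hα : ∀ᵐ ω ∂μ, Tendsto (fun n => α n ω) atTop (𝓝 (α' ω)))
    (hg : ∀ᵐ ω ∂μ, Tendsto (fun n => g n ω) atTop (𝓝 (g' ω))) :
    ∃ ζ : ℕ → ℕ → Ω → Portfolio d N,
      (∀ n, IsStrategyFor μ ℱ T K R t ((divergenceSet fun n => ξ n t).indicator (α n))
        ((divergenceSet fun n => ξ n t).indicator (g n)) (ζ n)) ∧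
      (∀ ω ∉ divergenceSet fun n => ξ n t, ∀ n s, ζ n s ω = 0) ∧
      ∀ᵐ ω ∂μ, ω ∈ (divergenceSet fun n => ξ n t) →
        {i | ∃ n, (ζ n t ω).1 i ≠ 0}.ncard < {i | ∃ n, (ξ n t ω).1 i ≠ 0}.ncard := by
  have hB := measurableSet_divergenceSet fun n => (h n).measurable t ht.le
  obtain ⟨z, hz, hz0, hzi⟩ := hcl.exists_direction hM ht hαm h hα hg
  set B := divergenceSet fun n => ξ n t with hBdef
  have hlin := hM.mem_lineality t z hz.measurable hz.feasible
  -- The multiple of `z` depends on first transfers only, so it is known at date `t` and may be used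
  -- at all later dates.
  let b : ℕ → Ω → ℝ := fun n ω => leadingRatio (ξ n t ω).1 (z t ω).1
  have hbm : ∀ n, Measurable[ℱ t] (b n) := fun n => measurable_leadingRatio.comp
    ((measurable_fst.comp ((h n).measurable t ht.le)).prodMk
      (measurable_fst.comp (hz.measurable t ht.le)))
  have hsub : ∀ n, IsStrategyFor μ ℱ T K R t (α n) (g n) (fun s ω => ξ n s ω - b n ω • z s ω) := by
    refine fun n => ⟨fun s hs => ?_, fun s hs ω => ?_, ?_⟩
    · rcases lt_or_ge s t with hst | hst
      · have : (fun ω => ξ n s ω - b n ω • z s ω) = fun _ => 0 := funext fun ω => by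
          rw [(h n).zero_of_lt s hst, hz.zero_of_lt s hst, smul_zero, sub_zero]
        rw [this]
        exact measurable_const
      · exact ((h n).measurable s hs).sub
          (((hbm n).mono (ℱ.mono hst) le_rfl).smul (hz.measurable s hs))
    · rw [(h n).zero_of_lt s hs, hz.zero_of_lt s hs, smul_zero, sub_zero]
    · filter_upwards [(h n).feasible, hz.feasible, hlin, hM.cone, hM.map_zero] with ω h1 h2 h3 h4 h5
      refine h1.sub_smul h4 (fun s hs => hz.zero_of_lt s hs ω) h3 ?_ _
      have hw := h2.wealth
      rwa [Finset.sum_eq_zero (s := Finset.Ico t T), add_zero] at hw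
      intro s hs
      have hsT := (Finset.mem_Ico.1 hs).2
      rw [holdings_of_eq_zero fun u hu => (h3 u (hu.trans hsT.le)).1.2]
      exact h5 _ hsT
  refine ⟨fun n s => B.indicator fun ω => ξ n s ω - b n ω • z s ω,
    fun n => (hsub n).indicator hM hB, fun ω hω n s => by simp [hω], ?_⟩
  filter_upwards [hlin] with ω hω hωB
  have hzne : (z t ω).1 ≠ 0 := fun h0 => hz0 ω hωB (Prod.ext h0 (hω t ht.le).1.2)
  have := ncard_sub_leadingRatio_lt (y := fun n => (ξ n t ω).1) hzne (hzi ω)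
  simpa [hωB] using this

/-- Induction on a bound for the number of financial coordinates that are nonzero in some `ξ n t`.
Industrial coordinates need no count, because the limiting direction is purely financial. With bound
0 nothing is left to eliminate, so divergence has probability zero. -/
theorem ReachableClosed.pred (hM : IsRegularModel μ ℱ T K R) (ht : t < T)
    (hcl : ReachableClosed μ ℱ T K R (t + 1)) : ReachableClosed μ ℱ T K R t := by
  suffices key : ∀ k : ℕ, ∀ (α : ℕ → Ω → Fin N → ℝ) (g : ℕ → Ω → Portfolio d N)
      (α' : Ω → Fin N → ℝ) (g' : Ω → Portfolio d N) (ξ : ℕ → ℕ → Ω → Portfolio d N),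
      (∀ n, Measurable[ℱ t] (α n)) → (∀ n, IsStrategyFor μ ℱ T K R t (α n) (g n) (ξ n)) →
      (∀ᵐ ω ∂μ, Tendsto (fun n => α n ω) atTop (𝓝 (α' ω))) →
      (∀ᵐ ω ∂μ, Tendsto (fun n => g n ω) atTop (𝓝 (g' ω))) →
      (∀ᵐ ω ∂μ, {i | ∃ n, (ξ n t ω).1 i ≠ 0}.ncard ≤ k) → Reachable μ ℱ T K R t α' g' by
    intro α g α' g' hαm h hα hg
    choose ξ hξ using h
    refine key d α g α' g' ξ hαm hξ hα hg (ae_of_all _ fun ω => ?_)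
    simpa using ncard_le_card {i | ∃ n, (ξ n t ω).1 i ≠ 0}
  intro k
  induction k with
  | zero =>
    intro α g α' g' ξ hαm h hα hg hcard
    have hreach := hcl.reachable_compl_divergenceSet hM ht hαm h hα hg
    obtain ⟨ζ, -, -, hlt⟩ := hcl.exists_reduction hM ht hαm h hα hg
    have hnot : ∀ᵐ ω ∂μ, ω ∈ (divergenceSet fun n => ξ n t)ᶜ := by
      filter_upwards [hcard, hlt] with ω h1 h2 hω
      exact absurd (h2 hω) (by lia)
    exact hreach.congr_ae (hnot.mono fun ω hω => indicator_of_mem hω _)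
      (hnot.mono fun ω hω => indicator_of_mem hω _)
  | succ k ih =>
    intro α g α' g' ξ hαm h hα hg hcard
    have hB := measurableSet_divergenceSet fun n => (h n).measurable t ht.le
    obtain ⟨ζ, hζ, hζ0, hlt⟩ := hcl.exists_reduction hM ht hαm h hα hg
    refine Reachable.of_indicator hB ?_ (hcl.reachable_compl_divergenceSet hM ht hαm h hα hg)
    refine ih _ _ _ _ ζ (fun n => (hαm n).indicator hB) hζ
      (hα.mono fun ω hω => tendsto_indicator _ hω) (hg.mono fun ω hω => tendsto_indicator _ hω) ?_
    filter_upwards [hcard, hlt] with ω h1 h2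
    by_cases hω : ω ∈ divergenceSet fun n => ξ n t
    · have := h2 hω
      lia
    · simp [hζ0 ω hω]

theorem IsRegularModel.reachableClosed (hM : IsRegularModel μ ℱ T K R) (ht : t ≤ T) :
    ReachableClosed μ ℱ T K R t :=
  Nat.decreasingInduction (motive := fun t _ => ReachableClosed μ ℱ T K R t)
    (fun _ hs ih => ih.pred hM hs) (reachableClosed_terminal hM) ht

theorem isRegularModel (hd : 1 ≤ d) (hK : IsSolvencyProcess μ ℱ T K) (hR : IsReturnProcess ℱ T R)
    (hR1 : CondR1 μ T R) (hR2 : CondR2 μ T K R) (hNA : RobustNoArbitrage μ ℱ T K R) :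
    IsRegularModel μ ℱ T K R := by
  have h1 : ∀ᵐ ω ∂μ, ∀ s ≤ T, R s ω 0 = 0 ∧ ContinuousOn (R s ω) {x | 0 ≤ x} := by
    rw [ae_all_iff]
    intro s
    by_cases hs : s ≤ T
    · filter_upwards [hR1 s hs] with ω hω _ using hω
    · exact ae_of_all _ fun ω hs' => absurd hs' hs
  exact
    { cone := hK.ae_isSolvencyCone
      map_zero := h1.mono fun ω hω s hs => (hω s hs).1
      continuousOn := h1.mono fun ω hω s hs => (hω s hs).2
      financial := hR.financial
      isRandomMap := hR.isRandomMap hR1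
      sub_smul_mem := hR2.ae_sub_smul_mem hR1 hK
      mem_lineality := fun t ξ hξ h => hNA.ae_mem_lineality hd hK hR hR1 hξ h }

end Closedness

/-! ### Back to reachable pairs and the solid envelope. -/

section Claims

variable {Ω : Type*} {m : MeasurableSpace Ω} {d N : ℕ} {μ : Measure Ω} {ℱ : Filtration ℕ m}
  {T t : ℕ} {K : ℕ → Ω → Set (Portfolio d N)} {R : ℕ → Ω → (Fin N → ℝ) → Portfolio d N}

theorem reachable_of_mem_wealthFrom {p : (Ω → Fin N → ℝ) × (Ω → Portfolio d N)}
    (hp : p ∈ wealthFrom μ ℱ T K R t) : Reachable μ ℱ T K R t p.1 p.2 := by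
  obtain ⟨-, -, -, ξ, ⟨hξm, hξ0, hξK, hξI⟩, hw⟩ := hp
  refine ⟨fun s => if s < t then 0 else ξ s, fun s hs => ?_, fun s hs ω => by simp [hs], ?_⟩
  · split_ifs
    · exact measurable_const
    · exact hξm s hs
  · have h1 : ∀ᵐ ω ∂μ, ∀ s, s < t → ξ s ω = 0 := by
      simpa only [ae_all_iff] using hξ0
    have h2 : ∀ᵐ ω ∂μ, ∀ s, t ≤ s → s ≤ T → -ξ s ω ∈ K s ω := by
      simpa only [ae_all_iff] using hξK
    have h3 : ∀ᵐ ω ∂μ, ∀ s, t ≤ s → s < T → 0 ≤ invested ξ s ω + p.1 ω := by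
      simpa only [ae_all_iff] using hξI
    filter_upwards [h1, h2, h3, hw] with ω h1 h2 h3 hw
    have heq : (fun s => (if s < t then 0 else ξ s) ω) = (ξ · ω) := by
      funext s
      by_cases hs : s < t
      · simp [hs, h1 s hs]
      · simp [hs]
    rw [heq]
    exact ⟨h1, h2, h3, hw⟩

theorem Reachable.mem_wealthFrom {α : Ω → Fin N → ℝ} {g : Ω → Portfolio d N}
    (h : Reachable μ ℱ T K R t α g) (hα : Measurable[ℱ t] α) (hα0 : ∀ᵐ ω ∂μ, 0 ≤ α ω)
    (hg : Measurable[ℱ T] g) : (α, g) ∈ wealthFrom μ ℱ T K R t := by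
  obtain ⟨ξ, hξ⟩ := h
  refine ⟨hα, hα0, hg, ξ, ⟨hξ.measurable, fun s hs => ae_of_all _ (hξ.zero_of_lt s hs),
    fun s hs hsT => ?_, fun s hs hsT => ?_⟩, ?_⟩
  · filter_upwards [hξ.feasible] with ω hω using hω.neg_mem s hs hsT
  · filter_upwards [hξ.feasible] with ω hω using hω.nonneg s hs hsT
  · filter_upwards [hξ.feasible] with ω hω using hω.wealth

theorem wealthFrom_closed (hM : IsRegularModel μ ℱ T K R) (ht : t ≤ T)
    {α : ℕ → Ω → Fin N → ℝ} {g : ℕ → Ω → Portfolio d N} {α' : Ω → Fin N → ℝ}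
    {g' : Ω → Portfolio d N} (h : ∀ n, (α n, g n) ∈ wealthFrom μ ℱ T K R t)
    (hαm : Measurable[ℱ t] α') (hgm : Measurable[ℱ T] g') (hα : TendstoInMeasure μ α atTop α')
    (hg : TendstoInMeasure μ g atTop g') : (α', g') ∈ wealthFrom μ ℱ T K R t := by
  obtain ⟨u, hu, hαu⟩ := hα.exists_seq_tendsto_ae
  obtain ⟨v, hv, hgv⟩ := (hg.comp hu.tendsto_atTop).exists_seq_tendsto_ae
  have hαv : ∀ᵐ ω ∂μ, Tendsto (fun n => α (u (v n)) ω) atTop (𝓝 (α' ω)) :=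
    hαu.mono fun ω hω => hω.comp hv.tendsto_atTop
  refine (hM.reachableClosed ht _ _ α' g' (fun n => (h (u (v n))).1)
    (fun n => reachable_of_mem_wealthFrom (h (u (v n)))) hαv hgv).mem_wealthFrom hαm ?_ hgm
  filter_upwards [hαv, ae_all_iff.2 fun n => (h n).2.1] with ω h1 h2
  exact ge_of_tendsto' h1 fun n => h2 _

/-- The disposed amount is absorbed into the last transfer, which is harmless since the sign
constraint stops at `T - 1`. -/
theorem mem_wealthFrom_of_mem_solidAttainable (hK : ∀ᵐ ω ∂μ, ∀ s ≤ T, IsSolvencyCone (K s ω))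
    {x : Portfolio d N} (hx : 0 ≤ x.2) {g : Ω → Portfolio d N}
    (hg : g ∈ solidAttainable μ ℱ T K R x) :
    (fun _ => x.2, fun ω => g ω - x) ∈ wealthFrom μ ℱ T K R 0 := by
  obtain ⟨hgm, f, ⟨-, ξ, hξ, hf⟩, k, hkm, hk, hgf⟩ := hg
  let ζ : ℕ → Ω → Portfolio d N := fun s => if s = T then ξ s - k else ξ s
  have hζ : ∀ s, s ≠ T → ζ s = ξ s := fun s hs => if_neg hs
  have hinv : ∀ s < T, ∀ ω, invested ζ s ω = invested ξ s ω := fun s hs ω =>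
    Finset.sum_congr rfl fun u hu => by
      rw [hζ u (by have := Finset.mem_range.1 hu; lia)]
  refine ⟨measurable_const, ae_of_all _ fun _ => hx, hgm.sub measurable_const, ζ,
    ⟨fun s hs => ?_, fun s hs => absurd hs (Nat.not_lt_zero s), fun s _ hs => ?_,
      fun s _ hs => ?_⟩, ?_⟩
  · simp only [ζ]
    split_ifs with h
    · subst h
      exact (hξ s hs).1.sub hkm
    · exact (hξ s hs).1
  · simp only [ζ]
    split_ifs with h
    · subst h
      filter_upwards [(hξ s hs).2.1, hk, hK] with ω h1 h2 h3
      have := (h3 s hs).add_mem h1 h2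
      rwa [Pi.sub_apply, neg_sub, sub_eq_neg_add]
    · exact (hξ s hs).2.1
  · filter_upwards [(hξ s hs.le).2.2] with ω h1
    rwa [hinv s hs]
  · filter_upwards [hf, hgf] with ω h1 h2
    have e1 : Finset.Icc 0 T = Finset.range (T + 1) := by
      ext u
      simp
    have e2 : Finset.Ico 0 T = Finset.range T := by
      ext u
      simp
    have e3 : ∑ s ∈ Finset.range (T + 1), ζ s ω = ∑ s ∈ Finset.range (T + 1), ξ s ω - k ω := by
      rw [Finset.sum_range_succ, Finset.sum_range_succ _ T, add_sub_assoc]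
      congr 1
      · exact Finset.sum_congr rfl fun s hs => by rw [hζ s (Finset.mem_range.1 hs).ne]
      · simp [ζ]
    have e4 : ∑ s ∈ Finset.range T, R (s + 1) ω (invested ζ s ω + x.2)
        = ∑ s ∈ Finset.range T, R (s + 1) ω (x.2 + invested ξ s ω) :=
      Finset.sum_congr rfl fun s hs => by rw [hinv s (Finset.mem_range.1 hs), add_comm x.2]
    rw [e1, e2, e3, e4, h2, h1]
    abel

/-- The last transfer is replaced by zero and counted as disposal. The holding at `T` is then that
of `T - 1`, hence nonnegative; this date exists because `1 ≤ T`. -/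
theorem mem_solidAttainable_of_mem_wealthFrom (hT : 1 ≤ T)
    (hK : ∀ᵐ ω ∂μ, ∀ s ≤ T, IsSolvencyCone (K s ω)) {x : Portfolio d N} {g : Ω → Portfolio d N}
    (hgm : Measurable[ℱ T] g)
    (hg : (fun _ => x.2, fun ω => g ω - x) ∈ wealthFrom μ ℱ T K R 0) :
    g ∈ solidAttainable μ ℱ T K R x := by
  obtain ⟨-, -, -, ξ, ⟨hξm, -, hξK, hξI⟩, hw⟩ := hg
  let ζ : ℕ → Ω → Portfolio d N := fun s => if s = T then 0 else ξ s
  have hζ : ∀ s, s ≠ T → ζ s = ξ s := fun s hs => if_neg hs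
  have hinv : ∀ s < T, ∀ ω, invested ζ s ω = invested ξ s ω := fun s hs ω =>
    Finset.sum_congr rfl fun u hu => by
      rw [hζ u (by have := Finset.mem_range.1 hu; lia)]
  refine ⟨hgm, fun ω => g ω - ξ T ω, ⟨hgm.sub (hξm T le_rfl), ζ, fun s hs => ⟨?_, ?_, ?_⟩, ?_⟩,
    fun ω => -ξ T ω, (hξm T le_rfl).neg, hξK T (Nat.zero_le T) le_rfl, ae_of_all _ fun ω => by
      simp⟩
  · simp only [ζ]
    split_ifs
    · exact measurable_const
    · exact hξm s hs
  · simp only [ζ]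
    split_ifs
    · filter_upwards [hK] with ω h1
      simpa using (h1 s hs).zero_mem
    · exact hξK s (Nat.zero_le s) hs
  · rcases hs.eq_or_lt with rfl | hs
    · obtain ⟨u, rfl⟩ : ∃ u, s = u + 1 := ⟨s - 1, by lia⟩
      filter_upwards [hξI u (Nat.zero_le u) (Nat.lt_succ_self u)] with ω h1
      have : invested ζ (u + 1) ω = invested ξ u ω := by
        rw [← hinv u (Nat.lt_succ_self u) ω, invested, Finset.sum_range_succ]
        simp [ζ, invested]
      rwa [this]
    · filter_upwards [hξI s (Nat.zero_le s) hs] with ω h1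
      rwa [hinv s hs]
  · filter_upwards [hw] with ω hw
    have e1 : Finset.Icc 0 T = Finset.range (T + 1) := by
      ext u
      simp
    have e2 : Finset.Ico 0 T = Finset.range T := by
      ext u
      simp
    have e3 : ∑ s ∈ Finset.range (T + 1), ξ s ω = ∑ s ∈ Finset.range (T + 1), ζ s ω + ξ T ω := by
      rw [Finset.sum_range_succ, Finset.sum_range_succ _ T]
      simp only [ζ, if_true, Pi.zero_apply, add_zero]
      congr 1
      exact Finset.sum_congr rfl fun s hs => by rw [if_neg (Finset.mem_range.1 hs).ne]
    have e4 : ∑ s ∈ Finset.range T, R (s + 1) ω (invested ξ s ω + x.2)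
        = ∑ s ∈ Finset.range T, R (s + 1) ω (x.2 + invested ζ s ω) :=
      Finset.sum_congr rfl fun s hs => by rw [hinv s (Finset.mem_range.1 hs), add_comm x.2]
    rw [e1, e2, e3, e4, eq_sub_iff_add_eq] at hw
    rw [← hw]
    abel

end Claims

theorem lemma5p4 {Ω : Type*} {m : MeasurableSpace Ω} (μ : Measure Ω) [IsProbabilityMeasure μ]
    (T d N : ℕ) (hT : 1 ≤ T) (hd : 1 ≤ d) (hN : 1 ≤ N)
    (ℱ : Filtration ℕ m) (hℱT : ℱ T = m)
    (hℱ0 : ∀ B : Set Ω, MeasurableSet[ℱ 0] B → μ B = 0 ∨ μ B = 1)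
    (K : ℕ → Ω → Set (Portfolio d N)) (R : ℕ → Ω → (Fin N → ℝ) → Portfolio d N)
    (hK : IsSolvencyProcess μ ℱ T K) (hR : IsReturnProcess ℱ T R)
    (hR1 : CondR1 μ T R) (hR2 : CondR2 μ T K R) (hR3 : CondR3 μ ℱ T R)
    (hNA : RobustNoArbitrage μ ℱ T K R) :
    (∀ t ≤ T, ∀ (α : ℕ → Ω → Fin N → ℝ) (g : ℕ → Ω → Portfolio d N)
        (α' : Ω → Fin N → ℝ) (g' : Ω → Portfolio d N),
      (∀ n, (α n, g n) ∈ wealthFrom μ ℱ T K R t) →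
      Measurable[ℱ t] α' → Measurable[ℱ T] g' →
      TendstoInMeasure μ α atTop α' → TendstoInMeasure μ g atTop g' →
      (α', g') ∈ wealthFrom μ ℱ T K R t) ∧
    (∀ x : Portfolio d N, 0 ≤ x.2 →
      ∀ (g : ℕ → Ω → Portfolio d N) (g' : Ω → Portfolio d N),
      (∀ n, g n ∈ solidAttainable μ ℱ T K R x) → Measurable[ℱ T] g' →
      TendstoInMeasure μ g atTop g' →
      g' ∈ solidAttainable μ ℱ T K R x) := by
  have hM := isRegularModel hd hK hR hR1 hR2 hNA
  refine ⟨fun t ht α g α' g' h hα' hg' hα hg => wealthFrom_closed hM ht h hα' hg' hα hg,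
    fun x hx g g' h hgm hg => ?_⟩
  refine mem_solidAttainable_of_mem_wealthFrom hT hM.cone hgm <|
    wealthFrom_closed hM (Nat.zero_le T)
      (fun n => mem_wealthFrom_of_mem_solidAttainable hM.cone hx (h n)) measurable_const
      (hgm.sub measurable_const) (fun ε hε => ?_) fun ε hε => ?_
  · simp [hε.ne']
  · simpa using hg ε hε
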